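/- For $n\in\mathbb N_0$ let $H_n(x)=(-1)^n e^{x^2}\frac{d^n}{dx^n}e^{-x^2}$ be the Hermite polynomials, let $\gamma_n=2^n n!\sqrt{\pi}$, let $\psi_n(x)=e^{-x^2/2}H_n(x)/\sqrt{\gamma_n}$ be the Hermite functions, and let $\mathbb H_n=\mathrm{span}\{\psi_0,\dots,\psi_n\}$. For $\rho>0$ let $\mathcal S_\rho=\{z\in\mathbb C:\ \mathrm{Im}\,z\in[-\rho,\rho]\}$. **Theorem.** Let $\rho>0$, let $f$ be analytic in (a neighbourhood of) the closed strip $\mathcal S_\rho$, and suppose that there are $\sigma\in\mathbb R$ and constants $C,R$ with $|e^{z^2/2}f(z)|\le C|z|^\sigma$ for all $z\in\mathcal S_\rho$ with $|z|\ge R$. Then $$\widehat V:=\int_{\partial\mathcal S_\rho}|f(z)|\,|dz|=\int_{-\infty}^{\infty}\bigl(|f(x+\mathrm i\rho)|+|f(x-\mathrm i\rho)|\bigr)\,dx$$ is finite; for every $n\ge 0$ there is exactly one $h_n\in\mathbb H_n$ with $h_n(x_j)=f(x_j)$ at the zeros $x_0<\dots<x_n$ of $H_{n+1}$; and there is a real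 sequence $(\mathcal K_n)$ with $$\lim_{n\to\infty}\mathcal K_n=\frac{\widehat V}{2^{1/4}\pi^{3/4}\rho}$$ such that for every integer $n\ge\max\{\lfloor\sigma\rfloor,1\}$ $$\|f-h_n\|_{L^\infty(\mathbb R)}\le \mathcal K_n\,n^{1/4}e^{-\rho\sqrt{2n}} .$$ -/

import Mathlib

open MeasureTheory Filter Topology

noncomputable section

/-- The Hermite weight `ω(x) = exp (-x ^ 2)`. -/
def hermiteWeight (x : ℝ) : ℝ := Real.exp (-x ^ 2)

/-- The (physicists') Hermite polynomial `H_n`, given by the Rodrigues formula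
`H_n(x) = (-1) ^ n / ω(x) * ω⁽ⁿ⁾(x)`. -/
def hermiteH (n : ℕ) (x : ℝ) : ℝ :=
  (-1) ^ n / hermiteWeight x * iteratedDeriv n hermiteWeight x

/-- The normalization constant `γ_n = 2 ^ n * n! * √π`. -/
def hermiteGamma (n : ℕ) : ℝ := 2 ^ n * (n.factorial : ℝ) * Real.sqrt Real.pi

/-- The Hermite function `ψ_n(x) = exp (-x ^ 2 / 2) * H_n(x) / √γ_n`. -/
def hermitePsi (n : ℕ) (x : ℝ) : ℝ :=
  Real.exp (-x ^ 2 / 2) * hermiteH n x / Real.sqrt (hermiteGamma n)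

/-- The space `ℍ_n = span {ψ_0, …, ψ_n}` of (complex-valued) functions on the real line. -/
def hermiteSpan (n : ℕ) : Submodule ℂ (ℝ → ℂ) :=
  Submodule.span ℂ {g | ∃ k ≤ n, g = fun x : ℝ => ((hermitePsi k x : ℝ) : ℂ)}

/-- `g` belongs to `ℍ_n` and interpolates `f` at the real zeros of `H_{n+1}`. -/
def IsHermiteInterpolant (f : ℂ → ℂ) (n : ℕ) (g : ℝ → ℂ) : Prop :=
  g ∈ hermiteSpan n ∧ ∀ x : ℝ, hermiteH (n + 1) x = 0 → g x = f (x : ℂ)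

/-- The closed strip `S_ρ = {z : -ρ ≤ Im z ≤ ρ}`. -/
def closedStrip (ρ : ℝ) : Set ℂ := {z : ℂ | z.im ∈ Set.Icc (-ρ) ρ}

/-- The sum of the values of `|f|` at the two boundary points `x + iρ`, `x - iρ` of the strip. -/
def stripBoundaryAbs (f : ℂ → ℂ) (ρ : ℝ) (x : ℝ) : ℝ :=
  ‖f ((x : ℂ) + (ρ : ℂ) * Complex.I)‖ + ‖f ((x : ℂ) - (ρ : ℂ) * Complex.I)‖

/-- The integral of `|f|` with respect to arc length over the boundary of the strip `S_ρ`,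
that is, over the two lines `Im z = ρ` and `Im z = -ρ`. -/
def stripVHat (f : ℂ → ℂ) (ρ : ℝ) : ℝ := ∫ x : ℝ, stripBoundaryAbs f ρ x

end

/-!
Put `F(z) = exp (z² / 2) f(z)` and `N = n + 1`. As `ℍ_n` consists of the products of
`exp (-x² / 2)` with the polynomials of degree at most `n`, the interpolant is `exp (-x² / 2) q`
with `q` the Lagrange interpolant of `F` at the `N` zeros of `H_N`. These are real
(`splits_hermitePoly`) and simple, which gives existence and uniqueness. The residue theorem for
`F(z) / (H_N(z) (z - x))` in the strip (`integral_line_sub_integral_line`) then yields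

  `|f(x) - h_n(x)| ≤ exp (-x² / 2) |H_N(x)| / (2 π ρ) * ∫ |F| / |H_N| |dz|`

over the two boundary lines (`norm_sub_eval_le_of_strip`). Three estimates control the right-hand
side. In them `T` is the energy `(2 N + 1) u(0)² + u'(0)²` of `u(x) = exp (-x² / 2) H_N(x)`, which
solves `u'' = -(2 N + 1 - x²) u`.

* On the real line `u² ≤ 104 T (2 N + 1) ^ (-2 / 3)` (`exp_mul_hermitePoly_sq_le`). An energy with
  the weight `(2 N + 1 - x² + 2 μ) ^ (-1 / 2)`, `μ = (2 N + 1) ^ (1 / 3)`, decreases up to the turning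
  point, and beyond it `u²` is convex and tends to zero.
* On the imaginary axis `|H_N(i s)| exp (s² / 2)` solves `w'' = (2 N + 1 + s²) w`, so that at `s = ρ`
  it is at least `√(T / (2 N + 1)) sinh (ρ √(2 N + 1))` (`sqrt_hermiteEnergy_mul_sinh_le`).
* On the lines `Im z = ± ρ`, for large `N`, `|H_N(t ± i ρ)| ≥ c (1 + t²) ^ k |H_N(i ρ)|` for any
  prescribed `k` and a constant `c` independent of `N` (`exists_mul_norm_hermiteC_le`). The
  logarithmic derivative `G = H_N' / H_N` satisfies `(G - z)² = z² - 2 N - G'`, where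
  `|G'| ≤ -Im G / Im z`, because `G = ∑ 1 / (z - x_j)`. Hence `G` is close to a root of a quadratic
  equation, and its real part is bounded below.

Since `|F|` grows at most polynomially on the boundary lines, the error is
`O (n ^ (1 / 6) exp (-ρ √(2 n)))`. This is smaller than the asserted bound by a factor of the order
`n ^ (1 / 12)`, so the sequence `K_n` can be taken as the prescribed limit plus a multiple of
`n ^ (-1 / 12)` for large `n`; for each of the finitely many other `n` the error is merely bounded.
-/

/-! ### Hermite polynomials: recurrence, zeros, complex extension -/

section HermitePolynomials

open Polynomial

/-- The Hermite polynomial `H_n` as an element of `ℝ[X]`, defined by `H_{n+1} = 2 X H_n - H_n'`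
instead of the Rodrigues formula; `hermiteH_eq_eval` identifies the two. -/
noncomputable def hermitePoly : ℕ → ℝ[X]
  | 0 => 1
  | n + 1 => C 2 * X * hermitePoly n - derivative (hermitePoly n)

theorem hermitePoly_zero : hermitePoly 0 = 1 := rfl

theorem hermitePoly_succ (n : ℕ) :
    hermitePoly (n + 1) = C 2 * X * hermitePoly n - derivative (hermitePoly n) := rfl

theorem derivative_hermitePoly_succ (n : ℕ) :
    derivative (hermitePoly (n + 1)) = C (2 * ((n : ℝ) + 1)) * hermitePoly n := by
  induction n with
  | zero => simp [hermitePoly]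
  | succ n ih =>
    rw [hermitePoly_succ (n + 1)]
    simp only [derivative_sub, derivative_mul, derivative_C, derivative_X, ih]
    rw [hermitePoly_succ n]
    simp only [map_mul, map_add, map_natCast, map_one, Nat.cast_add, Nat.cast_one]
    ring

/-- Hermite's differential equation `P'' = 2 x P' - 2 n P`. -/
theorem derivative_derivative_hermitePoly (n : ℕ) :
    derivative (derivative (hermitePoly n)) =
      C 2 * X * derivative (hermitePoly n) - C (2 * (n : ℝ)) * hermitePoly n := by
  have h := derivative_hermitePoly_succ n
  rw [hermitePoly_succ n] at h
  simp only [derivative_sub, derivative_mul, derivative_C, derivative_X, map_mul, map_add,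
    map_natCast, map_one] at h ⊢
  linear_combination -h

theorem hermitePoly_degree_leadingCoeff (n : ℕ) :
    (hermitePoly n).natDegree = n ∧ (hermitePoly n).leadingCoeff = 2 ^ n := by
  induction n with
  | zero => simp [hermitePoly]
  | succ n ih =>
    have hne : hermitePoly n ≠ 0 := by
      intro h
      have := ih.2
      rw [h, leadingCoeff_zero] at this
      exact (pow_ne_zero n (two_ne_zero' ℝ)) this.symm
    have h2 : (C (2 : ℝ) * X) ≠ 0 := mul_ne_zero (by simp) X_ne_zero
    have hd : (C 2 * X * hermitePoly n).natDegree = n + 1 := by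
      rw [natDegree_mul h2 hne, ih.1, natDegree_C_mul_X _ (two_ne_zero' ℝ), add_comm]
    have hlt : (derivative (hermitePoly n)).natDegree < (C 2 * X * hermitePoly n).natDegree := by
      rw [hd]
      exact lt_of_le_of_lt (natDegree_derivative_le _) (by omega)
    rw [hermitePoly_succ]
    refine ⟨by rw [natDegree_sub_eq_left_of_natDegree_lt hlt, hd], ?_⟩
    rw [leadingCoeff_sub_of_degree_lt (degree_lt_degree hlt), leadingCoeff_mul, leadingCoeff_mul,
      ih.2, leadingCoeff_C, leadingCoeff_X, pow_succ]
    ring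

theorem natDegree_hermitePoly (n : ℕ) : (hermitePoly n).natDegree = n :=
  (hermitePoly_degree_leadingCoeff n).1

theorem leadingCoeff_hermitePoly (n : ℕ) : (hermitePoly n).leadingCoeff = 2 ^ n :=
  (hermitePoly_degree_leadingCoeff n).2

theorem hermitePoly_ne_zero (n : ℕ) : hermitePoly n ≠ 0 := by
  intro h
  have := leadingCoeff_hermitePoly n
  rw [h, leadingCoeff_zero] at this
  exact (pow_ne_zero n (two_ne_zero' ℝ)) this.symm

theorem iteratedDeriv_hermiteWeight (n : ℕ) :
    iteratedDeriv n hermiteWeight =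
      fun x => (-1) ^ n * (hermitePoly n).eval x * Real.exp (-x ^ 2) := by
  induction n with
  | zero => funext x; simp [hermitePoly, hermiteWeight]
  | succ n ih =>
    rw [iteratedDeriv_succ, ih]
    funext x
    have h1 := ((hermitePoly n).hasDerivAt x).const_mul ((-1 : ℝ) ^ n)
    have h2 : HasDerivAt (fun x : ℝ => Real.exp (-x ^ 2)) (Real.exp (-x ^ 2) * (-(2 * x))) x := by
      simpa using ((hasDerivAt_pow 2 x).neg).exp
    rw [(h1.fun_mul h2).deriv, hermitePoly_succ]
    simp only [eval_sub, eval_mul, eval_C, eval_X]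
    ring

theorem hermiteH_eq_eval (n : ℕ) (x : ℝ) : hermiteH n x = (hermitePoly n).eval x := by
  have hs : ((-1 : ℝ) ^ n) * (-1) ^ n = 1 := by rw [← mul_pow]; simp
  have he := (Real.exp_pos (-x ^ 2)).ne'
  rw [hermiteH, iteratedDeriv_hermiteWeight, hermiteWeight, div_mul_eq_mul_div, div_eq_iff he]
  linear_combination (hermitePoly n).eval x * Real.exp (-x ^ 2) * hs

theorem im_mul_im_sum_inv_sub_nonpos (s : Multiset ℝ) (z : ℂ) :
    z.im * ((s.map fun r : ℝ => (1 : ℂ) / (z - r)).sum).im ≤ 0 := by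
  induction s using Multiset.induction_on with
  | empty => simp
  | cons r s ih =>
    have h : z.im * ((1 : ℂ) / (z - r)).im ≤ 0 := by
      rw [one_div, Complex.inv_im]
      simp only [Complex.sub_im, Complex.ofReal_im, sub_zero]
      rw [mul_div_assoc']
      exact div_nonpos_of_nonpos_of_nonneg (by nlinarith [mul_self_nonneg z.im])
        (Complex.normSq_nonneg _)
    simp only [Multiset.map_cons, Multiset.sum_cons, Complex.add_im]
    linarith

/-- If `p` has only real zeros, then so has `2 x p - p'`: off the real axis, `p' / p` has imaginary
part of the sign opposite to that of `z`, so it cannot equal `2 z`. -/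
theorem splits_two_mul_X_mul_sub_derivative {p : ℝ[X]} (hp : p.Splits) :
    (C 2 * X * p - derivative p).Splits := by
  by_cases h0 : p = 0
  · simp [h0]
  refine Splits.of_splits_map (algebraMap ℝ ℂ) (IsAlgClosed.splits _) fun z hz => ?_
  have hz := (mem_roots'.1 hz).2
  suffices z.im = 0 from ⟨z.re, by apply Complex.ext <;> simp [this]⟩
  by_contra him
  have hpm : (p.map (algebraMap ℝ ℂ)).Splits := hp.map _
  have hroots : (p.map (algebraMap ℝ ℂ)).roots = p.roots.map (algebraMap ℝ ℂ) :=
    hp.roots_map _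
  have hne : (p.map (algebraMap ℝ ℂ)).eval z ≠ 0 := by
    intro h
    have hm : z ∈ (p.map (algebraMap ℝ ℂ)).roots :=
      mem_roots'.2 ⟨(Polynomial.map_ne_zero_iff (algebraMap ℝ ℂ).injective).2 h0, h⟩
    rw [hroots, Multiset.mem_map] at hm
    obtain ⟨r, -, rfl⟩ := hm
    exact him (by simp)
  have hs := hpm.eval_derivative_div_eval_of_ne_zero hne
  have hz' : 2 * z = (p.map (algebraMap ℝ ℂ)).derivative.eval z /
      (p.map (algebraMap ℝ ℂ)).eval z := by
    rw [eq_div_iff hne]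
    have : ((C 2 * X * p - derivative p).map (algebraMap ℝ ℂ)).eval z = 0 := hz
    simp only [Polynomial.map_sub, Polynomial.map_mul, map_C, map_X, eval_sub, eval_mul, eval_C,
      eval_X, ← derivative_map] at this
    simp at this ⊢
    linear_combination this
  rw [hs, hroots, Multiset.map_map] at hz'
  have hsgn := im_mul_im_sum_inv_sub_nonpos p.roots z
  have heq : (p.roots.map fun r : ℝ => (1 : ℂ) / (z - r)).sum = 2 * z := by
    rw [hz']; rfl
  rw [heq] at hsgn
  have h2 : ((2 : ℂ) * z).im = 2 * z.im := by simp
  rw [h2] at hsgn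
  have := mul_self_pos.2 him
  nlinarith

theorem splits_hermitePoly (n : ℕ) : (hermitePoly n).Splits := by
  induction n with
  | zero => rw [hermitePoly_zero]; exact Splits.one
  | succ n ih => exact splits_two_mul_X_mul_sub_derivative ih

/-- The zeros of `H_n` are simple: by the recurrence, a common zero of `H_n` and `H_n'` would be one of
`H_{n-1}` and `H_{n-1}'`, and so on down to `H_0 = 1`. -/
theorem not_isRoot_hermitePoly_and_derivative (n : ℕ) (x : ℝ) :
    ¬((hermitePoly n).eval x = 0 ∧ (derivative (hermitePoly n)).eval x = 0) := by
  induction n with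
  | zero => simp [hermitePoly]
  | succ n ih =>
    rintro ⟨h1, h2⟩
    rw [derivative_hermitePoly_succ, eval_mul, eval_C, mul_eq_zero] at h2
    have h3 : (hermitePoly n).eval x = 0 := h2.resolve_left (by positivity)
    refine ih ⟨h3, ?_⟩
    rw [hermitePoly_succ, eval_sub, eval_mul, h3] at h1
    linarith

/-- The set of zeros of `H_n`. -/
noncomputable def hermiteZeros (n : ℕ) : Finset ℝ := (hermitePoly n).roots.toFinset

theorem roots_hermitePoly_nodup (n : ℕ) : (hermitePoly n).roots.Nodup := by
  classical
  rw [Multiset.nodup_iff_count_le_one]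
  intro x
  rw [count_roots]
  by_contra! h
  exact not_isRoot_hermitePoly_and_derivative n x
    ((one_lt_rootMultiplicity_iff_isRoot (hermitePoly_ne_zero n)).1 h)

theorem mem_hermiteZeros {n : ℕ} {x : ℝ} : x ∈ hermiteZeros n ↔ hermiteH n x = 0 := by
  rw [hermiteZeros, Multiset.mem_toFinset, mem_roots (hermitePoly_ne_zero n), hermiteH_eq_eval]
  rfl

theorem card_hermiteZeros (n : ℕ) : (hermiteZeros n).card = n := by
  rw [hermiteZeros, Multiset.toFinset_card_of_nodup (roots_hermitePoly_nodup n),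
    ← (splits_hermitePoly n).natDegree_eq_card_roots, natDegree_hermitePoly]

theorem hermitePoly_eq_prod (n : ℕ) :
    hermitePoly n = C (2 ^ n) * ∏ x ∈ hermiteZeros n, (X - C x) := by
  conv_lhs => rw [(splits_hermitePoly n).eq_prod_roots, leadingCoeff_hermitePoly]
  rw [hermiteZeros, Finset.prod_eq_multiset_prod, Multiset.toFinset_val,
    (roots_hermitePoly_nodup n).dedup]

/-- `H_n` as an entire function. -/
noncomputable def hermiteC (n : ℕ) (z : ℂ) : ℂ := aeval z (hermitePoly n)

theorem hermiteC_ofReal (n : ℕ) (x : ℝ) : hermiteC n x = ((hermiteH n x : ℝ) : ℂ) := by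
  rw [hermiteH_eq_eval, hermiteC]
  exact (aeval_algebraMap_apply ℂ x (hermitePoly n)).trans (by simp)

theorem hermiteC_eq_prod (n : ℕ) (z : ℂ) :
    hermiteC n z = 2 ^ n * ∏ x ∈ hermiteZeros n, (z - (x : ℂ)) := by
  rw [hermiteC, hermitePoly_eq_prod]
  simp

theorem hermiteC_ne_zero (n : ℕ) {z : ℂ} (hz : z.im ≠ 0) : hermiteC n z ≠ 0 := by
  rw [hermiteC_eq_prod]
  refine mul_ne_zero (by simp) (Finset.prod_ne_zero_iff.2 fun x _ h => hz ?_)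
  rw [sub_eq_zero.1 h]; simp

theorem hasDerivAt_hermiteC (n : ℕ) (z : ℂ) :
    HasDerivAt (hermiteC n) (aeval z (derivative (hermitePoly n))) z :=
  (hermitePoly n).hasDerivAt_aeval z

theorem norm_hermiteC_conj (n : ℕ) (z : ℂ) :
    ‖hermiteC n (starRingEnd ℂ z)‖ = ‖hermiteC n z‖ := by
  have : hermiteC n (starRingEnd ℂ z) = starRingEnd ℂ (hermiteC n z) := by
    rw [hermiteC_eq_prod, hermiteC_eq_prod]; simp [map_ofNat (starRingEnd ℂ) 2]
  rw [this, Complex.norm_conj]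

theorem hermitePoly_comp_neg_X (n : ℕ) :
    (hermitePoly n).comp (-X) = C ((-1) ^ n) * hermitePoly n := by
  induction n with
  | zero => simp [hermitePoly]
  | succ n ih =>
    have hd : (derivative (hermitePoly n)).comp (-X) =
        - (C ((-1) ^ n) * derivative (hermitePoly n)) := by
      have h := congrArg derivative ih
      rw [derivative_comp] at h
      simp only [derivative_neg, derivative_X, derivative_mul, derivative_C] at h
      linear_combination -h
    rw [hermitePoly_succ, sub_comp, mul_comp, mul_comp, C_comp, X_comp, ih, hd, pow_succ]
    simp only [map_mul, map_neg, map_one]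
    ring

theorem hermiteC_neg (n : ℕ) (z : ℂ) : hermiteC n (-z) = (-1) ^ n * hermiteC n z := by
  have h := congrArg (aeval z) (hermitePoly_comp_neg_X n)
  rw [aeval_comp] at h
  simpa [hermiteC] using h

end HermitePolynomials

/-! ### Energy estimates for the oscillator equations `u'' = ∓(λ ∓ x²) u` -/

section Oscillator

/-- The derivative of the weighted energy
`(φ u² + v²) / r - (x / r³) u v + (1 / r³ + 3 x² / r⁵) u² / 2` along a solution of
`u'' = -φ u`, `φ = μ³ - x²`, `r² = φ + 2 μ`. All terms but those in `u²` cancel. -/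
theorem hasDerivAt_weightedEnergy {u v r : ℝ → ℝ} {μ x : ℝ}
    (hu : HasDerivAt u (v x) x) (hv : HasDerivAt v (-(μ ^ 3 - x ^ 2) * u x) x)
    (hr : HasDerivAt r (-x / r x) x) (hr0 : 0 < r x) (hr2 : r x ^ 2 = μ ^ 3 - x ^ 2 + 2 * μ) :
    HasDerivAt (fun x => ((μ ^ 3 - x ^ 2) * u x ^ 2 + v x ^ 2) / r x - x / r x ^ 3 * (u x * v x)
        + (1 / r x ^ 3 + 3 * x ^ 2 / r x ^ 5) * u x ^ 2 / 2)
      (x * u x ^ 2 / r x ^ 7 * (-4 * μ * r x ^ 4 + 9 / 2 * r x ^ 2 + 15 / 2 * x ^ 2)) x := by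
  have hne := hr0.ne'
  have hx := hasDerivAt_id x
  have hφ : HasDerivAt (fun x : ℝ => μ ^ 3 - x ^ 2) (-(2 * x)) x := by
    simpa using (hasDerivAt_pow 2 x).const_sub (μ ^ 3)
  have h1 := ((hφ.fun_mul (hu.fun_pow 2)).fun_add (hv.fun_pow 2)).fun_div hr hne
  have h2 := (hx.fun_div (hr.fun_pow 3) (pow_ne_zero 3 hne)).fun_mul (hu.fun_mul hv)
  have h3 := (((hasDerivAt_const x (1 : ℝ)).fun_div (hr.fun_pow 3) (pow_ne_zero 3 hne)).fun_add
    (((hasDerivAt_pow 2 x).const_mul 3).fun_div (hr.fun_pow 5) (pow_ne_zero 5 hne))).fun_mul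
      (hu.fun_pow 2) |>.div_const 2
  refine ((h1.fun_sub h2).fun_add h3).congr_deriv ?_
  have hμ : μ ^ 3 = r x ^ 2 + x ^ 2 - 2 * μ := by linarith
  simp only [id, hμ]
  field_simp
  ring

/-- The weighted energy dominates a multiple of `√μ u²` up to the turning point `x² = μ³`. -/
theorem weightedEnergy_lower_bound {μ x r s u v : ℝ} (hμ : 2 ≤ μ) (hr0 : 0 < r) (hs : 0 < s)
    (hs2 : s ^ 2 = μ) (hr2 : r ^ 2 = μ ^ 3 - x ^ 2 + 2 * μ) (hx : x ^ 2 ≤ μ ^ 3) :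
    u ^ 2 * s ≤ 52 * (((μ ^ 3 - x ^ 2) * u ^ 2 + v ^ 2) / r - x / r ^ 3 * (u * v)
        + (1 / r ^ 3 + 3 * x ^ 2 / r ^ 5) * u ^ 2 / 2) := by
  -- Complete the square in `v`.
  have hkey : ((μ ^ 3 - x ^ 2) * u ^ 2 + v ^ 2) / r - x / r ^ 3 * (u * v)
        + (1 / r ^ 3 + 3 * x ^ 2 / r ^ 5) * u ^ 2 / 2 =
      (v - x * u / (2 * r ^ 2)) ^ 2 / r
        + u ^ 2 * ((μ ^ 3 - x ^ 2) / r + 1 / (2 * r ^ 3) + 5 / 4 * x ^ 2 / r ^ 5) := by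
    field_simp
    ring
  rw [hkey]
  have hφ : 0 ≤ μ ^ 3 - x ^ 2 := by linarith
  have h1 : 0 ≤ (μ ^ 3 - x ^ 2) / r := by positivity
  have h2 : 0 ≤ 1 / (2 * r ^ 3) := by positivity
  have h3 : 0 ≤ 5 / 4 * x ^ 2 / r ^ 5 := by positivity
  have h4 : 0 ≤ (v - x * u / (2 * r ^ 2)) ^ 2 / r := by positivity
  suffices s ≤ 52 * ((μ ^ 3 - x ^ 2) / r + 1 / (2 * r ^ 3) + 5 / 4 * x ^ 2 / r ^ 5) by
    nlinarith [mul_le_mul_of_nonneg_left this (sq_nonneg u)]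
  -- Away from the turning point the first term is of the order `r`; near it `r` is of the order `√μ`
  -- and the third term takes over.
  rcases le_total (2 * μ) (μ ^ 3 - x ^ 2) with h | h
  · have : s ≤ (μ ^ 3 - x ^ 2) / r := by
      rw [le_div_iff₀ hr0]
      have h5 : 2 * s ≤ r := abs_le_of_sq_le_sq' (by nlinarith) hr0.le |>.2
      nlinarith
    linarith
  · have h5 : r ≤ 2 * s := abs_le_of_sq_le_sq' (by nlinarith) (by positivity) |>.2
    have h6 : r ^ 5 ≤ 32 * (s * μ ^ 2) := by
      calc r ^ 5 ≤ (2 * s) ^ 5 := pow_le_pow_left₀ hr0.le h5 5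
        _ = 32 * (s * μ ^ 2) := by rw [← hs2]; ring
    have h7 : μ ^ 3 / 2 ≤ x ^ 2 := by
      nlinarith [mul_nonneg (by linarith : 0 ≤ μ) (by nlinarith : 0 ≤ μ ^ 2 - 4)]
    have : s / 52 ≤ 5 / 4 * x ^ 2 / r ^ 5 := by
      rw [le_div_iff₀ (by positivity)]
      have h8 : s * r ^ 5 ≤ 32 * μ ^ 3 := by
        calc s * r ^ 5 ≤ s * (32 * (s * μ ^ 2)) := mul_le_mul_of_nonneg_left h6 hs.le
          _ = 32 * μ ^ 3 := by rw [← hs2]; ring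
      nlinarith
    linarith

/-- A solution of `u'' = -(μ³ - x²) u` is at most of the order of its initial energy times
`μ^(-2)`, uniformly up to the turning point. -/
theorem sq_le_of_oscillator_of_sq_le {u v : ℝ → ℝ} {μ : ℝ} (hμ : 2 ≤ μ)
    (hu : ∀ x, HasDerivAt u (v x) x) (hv : ∀ x, HasDerivAt v (-(μ ^ 3 - x ^ 2) * u x) x)
    {x : ℝ} (hx0 : 0 ≤ x) (hx : x ^ 2 ≤ μ ^ 3) :
    u x ^ 2 * μ ^ 2 ≤ 104 * (μ ^ 3 * u 0 ^ 2 + v 0 ^ 2) := by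
  set r : ℝ → ℝ := fun x => √(μ ^ 3 - x ^ 2 + 2 * μ) with hr
  have hpos : ∀ y ∈ Set.Icc 0 x, 0 < μ ^ 3 - y ^ 2 + 2 * μ := fun y hy => by
    nlinarith [pow_le_pow_left₀ hy.1 hy.2 2]
  have hr0 : ∀ y ∈ Set.Icc 0 x, 0 < r y := fun y hy => Real.sqrt_pos.2 (hpos y hy)
  have hr2 : ∀ y ∈ Set.Icc 0 x, r y ^ 2 = μ ^ 3 - y ^ 2 + 2 * μ :=
    fun y hy => Real.sq_sqrt (hpos y hy).le
  have hrd : ∀ y ∈ Set.Icc 0 x, HasDerivAt r (-y / r y) y := fun y hy => by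
    have h1 : HasDerivAt (fun x : ℝ => μ ^ 3 - x ^ 2 + 2 * μ) (-(2 * y)) y := by
      simpa using ((hasDerivAt_pow 2 y).const_sub (μ ^ 3)).add_const (2 * μ)
    refine (h1.sqrt (hpos y hy).ne').congr_deriv ?_
    have := (hr0 y hy).ne'
    simp only [hr] at this ⊢
    field_simp
  have hd := fun y hy => hasDerivAt_weightedEnergy (hu y) (hv y) (hrd y hy) (hr0 y hy) (hr2 y hy)
  have hanti : AntitoneOn (fun x => ((μ ^ 3 - x ^ 2) * u x ^ 2 + v x ^ 2) / r x
      - x / r x ^ 3 * (u x * v x) + (1 / r x ^ 3 + 3 * x ^ 2 / r x ^ 5) * u x ^ 2 / 2)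
      (Set.Icc 0 x) := by
    refine antitoneOn_of_deriv_nonpos (convex_Icc 0 x)
      (fun y hy => (hd y hy).continuousAt.continuousWithinAt)
      (fun y hy => (hd y (interior_subset hy)).differentiableAt.differentiableWithinAt)
      fun y hy => ?_
    have hy := interior_subset hy
    rw [(hd y hy).deriv]
    have h1 := hr2 y hy
    have h2 := hr0 y hy
    have h3 : y ^ 2 ≤ μ ^ 3 := (pow_le_pow_left₀ hy.1 hy.2 2).trans hx
    refine mul_nonpos_of_nonneg_of_nonpos
      (div_nonneg (mul_nonneg hy.1 (sq_nonneg _)) (by positivity)) ?_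
    have h4 : 2 * μ ≤ r y ^ 2 := by rw [h1]; linarith
    have h5 : r y ^ 4 = r y ^ 2 * r y ^ 2 := by ring
    have h6 : 2 * μ * r y ^ 2 ≤ r y ^ 4 := by
      rw [h5]; exact mul_le_mul_of_nonneg_right h4 (sq_nonneg _)
    have h7 : 4 * μ ^ 2 ≤ r y ^ 4 := by nlinarith
    have h8 : 8 * μ ^ 3 ≤ 2 * μ * r y ^ 4 := by nlinarith
    have h9 : 9 / 2 * r y ^ 2 ≤ 2 * μ * r y ^ 4 := by
      have : 4 * r y ^ 2 ≤ r y ^ 4 := by nlinarith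
      nlinarith
    linarith [pow_nonneg (by linarith : 0 ≤ μ) 3]
  have hle := hanti (Set.left_mem_Icc.2 hx0) (Set.right_mem_Icc.2 hx0) hx0
  have hxm := Set.right_mem_Icc.2 hx0
  have hlow := weightedEnergy_lower_bound (u := u x) (v := v x) hμ (hr0 x hxm)
    (Real.sqrt_pos.2 (by linarith : 0 < μ)) (Real.sq_sqrt (by linarith : 0 ≤ μ)) (hr2 x hxm) hx
  have h0m := Set.left_mem_Icc.2 hx0
  have hR0 := hr0 0 h0m
  have hR2 := hr2 0 h0m
  simp only [ne_eq, OfNat.ofNat_ne_zero, not_false_eq_true, zero_pow, sub_zero, zero_div, zero_mul,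
    mul_zero, add_zero] at hle hR2
  set R := r 0
  set T := μ ^ 3 * u 0 ^ 2 + v 0 ^ 2
  have hμ3 : 8 ≤ μ ^ 3 := by nlinarith [pow_le_pow_left₀ (by norm_num) hμ 3]
  have hT : 1 / R ^ 3 * u 0 ^ 2 / 2 ≤ T / R := by
    rw [le_div_iff₀ hR0]
    have : 1 / R ^ 3 * u 0 ^ 2 / 2 * R = u 0 ^ 2 / (2 * R ^ 2) := by field_simp
    rw [this, div_le_iff₀ (by positivity), hR2]
    have h1 : u 0 ^ 2 ≤ T := by nlinarith [sq_nonneg (v 0), sq_nonneg (u 0)]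
    nlinarith [sq_nonneg (u 0)]
  have hE : u x ^ 2 * √μ ≤ 104 * (T / R) := by
    refine hlow.trans ?_
    linarith
  have hRs : μ * √μ ≤ R := by
    refine abs_le_of_sq_le_sq' ?_ hR0.le |>.2
    rw [hR2, mul_pow, Real.sq_sqrt (by linarith)]
    nlinarith
  rw [← mul_div_assoc, le_div_iff₀ hR0] at hE
  have hsm : √μ * √μ = μ := Real.mul_self_sqrt (by linarith)
  calc u x ^ 2 * μ ^ 2 = u x ^ 2 * √μ * (μ * √μ) := by linear_combination (-u x ^ 2 * μ) * hsm
    _ ≤ u x ^ 2 * √μ * R := mul_le_mul_of_nonneg_left hRs (by positivity)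
    _ ≤ 104 * T := hE

/-- Beyond the turning point the square of a solution is convex, so a solution vanishing at
infinity decreases there. -/
theorem sq_le_of_oscillator_of_le {u v : ℝ → ℝ} {l a : ℝ} (ha : ∀ x, a ≤ x → l ≤ x ^ 2)
    (hu : ∀ x, HasDerivAt u (v x) x) (hv : ∀ x, HasDerivAt v (-(l - x ^ 2) * u x) x)
    (hlim : Tendsto u atTop (𝓝 0)) {x : ℝ} (hx : a ≤ x) : u x ^ 2 ≤ u a ^ 2 := by
  -- If `u v` is positive somewhere, `u²` increases from there on.
  have hd1 : ∀ y, HasDerivAt (fun x => u x ^ 2) (2 * (u y * v y)) y := fun y => by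
    refine ((hu y).fun_pow 2).congr_deriv ?_
    simp; ring
  have hd2 : ∀ y, HasDerivAt (fun x => u x * v x) (v y ^ 2 + (y ^ 2 - l) * u y ^ 2) y :=
    fun y => ((hu y).fun_mul (hv y)).congr_deriv (by ring)
  have hmono : MonotoneOn (fun x => u x * v x) (Set.Ici a) := by
    refine monotoneOn_of_deriv_nonneg (convex_Ici a)
      (fun y _ => (hd2 y).continuousAt.continuousWithinAt)
      (fun y _ => (hd2 y).differentiableAt.differentiableWithinAt) fun y hy => ?_
    rw [(hd2 y).deriv]
    have := ha y (interior_subset hy)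
    nlinarith [sq_nonneg (v y), mul_nonneg (sub_nonneg.2 this) (sq_nonneg (u y))]
  have hneg : ∀ y ∈ Set.Ici a, u y * v y ≤ 0 := by
    intro y hy
    by_contra! hpos
    have hinc : MonotoneOn (fun x => u x ^ 2) (Set.Ici y) := by
      refine monotoneOn_of_deriv_nonneg (convex_Ici y)
        (fun y _ => (hd1 y).continuousAt.continuousWithinAt)
        (fun y _ => (hd1 y).differentiableAt.differentiableWithinAt) fun w hw => ?_
      rw [(hd1 w).deriv]
      have hw : y ≤ w := interior_subset hw
      have := hmono hy (le_trans hy hw : a ≤ w) hw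
      simp only at this
      linarith
    have h0 : u y ^ 2 ≤ 0 := by
      have hl : Tendsto (fun x => u x ^ 2) atTop (𝓝 0) := by simpa using hlim.pow 2
      refine ge_of_tendsto hl ?_
      filter_upwards [eventually_ge_atTop y] with w hw
      exact hinc (Set.mem_Ici.2 le_rfl) hw hw
    have : u y = 0 := by nlinarith [sq_nonneg (u y)]
    simp [this] at hpos
  have hanti : AntitoneOn (fun x => u x ^ 2) (Set.Ici a) := by
    refine antitoneOn_of_deriv_nonpos (convex_Ici a)
      (fun y _ => (hd1 y).continuousAt.continuousWithinAt)
      (fun y _ => (hd1 y).differentiableAt.differentiableWithinAt) fun y hy => ?_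
    rw [(hd1 y).deriv]
    linarith [hneg y (interior_subset hy)]
  exact hanti (Set.mem_Ici.2 le_rfl) hx hx

/-- Growth of a nonnegative solution of `w'' = (k² + s²) w`, by comparison with `w'' = k² w`. -/
theorem sinh_le_of_deriv_deriv_eq {w v : ℝ → ℝ} {k : ℝ} (hk : 0 < k)
    (hw : ∀ s, HasDerivAt w (v s) s) (hv : ∀ s, HasDerivAt v ((k ^ 2 + s ^ 2) * w s) s)
    (hpos : ∀ s, 0 ≤ s → 0 ≤ w s) (hv0 : 0 ≤ v 0) {s : ℝ} (hs : 0 ≤ s) :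
    √(k ^ 2 * w 0 ^ 2 + v 0 ^ 2) * Real.sinh (k * s) ≤ k * w s := by
  set c := v 0 + k * w 0
  have hw0 := hpos 0 le_rfl
  have hc : √(k ^ 2 * w 0 ^ 2 + v 0 ^ 2) ≤ c := by
    rw [Real.sqrt_le_left (by positivity)]
    nlinarith [mul_nonneg hv0 (mul_nonneg hk.le hw0)]
  have hem : ∀ a t : ℝ, HasDerivAt (fun t => Real.exp (a * t)) (Real.exp (a * t) * a) t :=
    fun a t => by simpa using ((hasDerivAt_id t).const_mul a).exp
  have hexp : ∀ t, Real.exp (-k * t) * Real.exp (k * t) = 1 := fun t => by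
    rw [← Real.exp_add]; simp
  -- First `(v + k w) e^(-k s)` increases, then `(w e^(k s))' = (v + k w) e^(k s) ≥ c e^(2 k s)`.
  have h1 : ∀ t, 0 ≤ t → c * Real.exp (k * t) ≤ v t + k * w t := by
    intro t ht
    have hd : ∀ y, HasDerivAt (fun t => (v t + k * w t) * Real.exp (-k * t))
        (y ^ 2 * w y * Real.exp (-k * y)) y := fun y =>
      (((hv y).fun_add ((hw y).const_mul k)).fun_mul (hem (-k) y)).congr_deriv (by ring)
    have hmono : MonotoneOn (fun t => (v t + k * w t) * Real.exp (-k * t)) (Set.Ici 0) := by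
      refine monotoneOn_of_deriv_nonneg (convex_Ici 0)
        (fun y _ => (hd y).continuousAt.continuousWithinAt)
        (fun y _ => (hd y).differentiableAt.differentiableWithinAt) fun y hy => ?_
      rw [(hd y).deriv]
      have := hpos y (interior_subset hy)
      positivity
    have := hmono (Set.mem_Ici.2 le_rfl) (Set.mem_Ici.2 ht) ht
    simp only [mul_zero, Real.exp_zero, mul_one] at this
    calc c * Real.exp (k * t) ≤ (v t + k * w t) * Real.exp (-k * t) * Real.exp (k * t) :=
          mul_le_mul_of_nonneg_right this (Real.exp_pos _).le
      _ = v t + k * w t := by rw [mul_assoc, hexp, mul_one]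
  have hd : ∀ y, HasDerivAt (fun t => 2 * k * (w t * Real.exp (k * t))
      - c * Real.exp (2 * k * t))
      (2 * k * Real.exp (k * y) * (v y + k * w y - c * Real.exp (k * y))) y := fun y => by
    refine ((((hw y).fun_mul (hem k y)).const_mul (2 * k)).fun_sub
      ((hem (2 * k) y).const_mul c)).congr_deriv ?_
    have : Real.exp (2 * k * y) = Real.exp (k * y) * Real.exp (k * y) := by
      rw [← Real.exp_add]; ring_nf
    rw [this]; ring
  have hmono : MonotoneOn (fun t => 2 * k * (w t * Real.exp (k * t))
      - c * Real.exp (2 * k * t)) (Set.Ici 0) := by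
    refine monotoneOn_of_deriv_nonneg (convex_Ici 0)
      (fun y _ => (hd y).continuousAt.continuousWithinAt)
      (fun y _ => (hd y).differentiableAt.differentiableWithinAt) fun y hy => ?_
    rw [(hd y).deriv]
    exact mul_nonneg (by positivity) (sub_nonneg.2 (h1 y (interior_subset hy)))
  have h2 := hmono (Set.mem_Ici.2 le_rfl) (Set.mem_Ici.2 hs) hs
  simp only [mul_zero, Real.exp_zero, mul_one] at h2
  have hc2 : c * Real.sinh (k * s) ≤ k * w s := by
    have he := Real.exp_pos (k * s)
    have h3 : Real.exp (2 * k * s) = Real.exp (k * s) * Real.exp (k * s) := by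
      rw [← Real.exp_add]; ring_nf
    have h4 : Real.exp (-(k * s)) * Real.exp (k * s) = 1 := by rw [← Real.exp_add]; simp
    have h5 : c * (Real.exp (k * s) * Real.exp (k * s) - 1) ≤ 2 * k * w s * Real.exp (k * s) := by
      rw [h3] at h2
      nlinarith [mul_nonneg hk.le hw0]
    rw [Real.sinh_eq]
    refine le_of_mul_le_mul_right ?_ he
    have : c * ((Real.exp (k * s) - Real.exp (-(k * s))) / 2) * Real.exp (k * s)
      = c * (Real.exp (k * s) * Real.exp (k * s) - 1) / 2 := by linear_combination (-c / 2) * h4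
    rw [this]; linarith
  refine le_trans (mul_le_mul_of_nonneg_right hc ?_) hc2
  exact Real.sinh_nonneg_iff.2 (by positivity)

end Oscillator

/-! ### Hermite polynomials on the real and on the imaginary axis -/

section HermiteBounds

open Polynomial

/-- The energy `(2 n + 1) u(0)² + u'(0)²` of `u(x) = exp (-x² / 2) H_n(x)` at the origin. -/
noncomputable def hermiteEnergy (n : ℕ) : ℝ :=
  (2 * n + 1) * (hermitePoly n).eval 0 ^ 2 + (derivative (hermitePoly n)).eval 0 ^ 2

theorem hermiteEnergy_nonneg (n : ℕ) : 0 ≤ hermiteEnergy n := by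
  rw [hermiteEnergy]; positivity

theorem hasDerivAt_exp_neg_sq_div_two (x : ℝ) :
    HasDerivAt (fun x : ℝ => Real.exp (-x ^ 2 / 2)) (Real.exp (-x ^ 2 / 2) * (-x)) x := by
  refine (((hasDerivAt_pow 2 x).fun_neg.div_const 2).exp).congr_deriv ?_
  simp
  ring

theorem hasDerivAt_exp_mul_hermitePoly (n : ℕ) (x : ℝ) :
    HasDerivAt (fun x : ℝ => Real.exp (-x ^ 2 / 2) * (hermitePoly n).eval x)
      (Real.exp (-x ^ 2 / 2) *
        ((derivative (hermitePoly n)).eval x - x * (hermitePoly n).eval x)) x := by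
  have h := hasDerivAt_exp_neg_sq_div_two x
  exact (h.fun_mul ((hermitePoly n).hasDerivAt x)).congr_deriv (by ring)

theorem hasDerivAt_deriv_exp_mul_hermitePoly (n : ℕ) (x : ℝ) :
    HasDerivAt (fun x : ℝ => Real.exp (-x ^ 2 / 2) *
        ((derivative (hermitePoly n)).eval x - x * (hermitePoly n).eval x))
      (-((2 * n + 1) - x ^ 2) * (Real.exp (-x ^ 2 / 2) * (hermitePoly n).eval x)) x := by
  have h := hasDerivAt_exp_neg_sq_div_two x
  have h2 := ((derivative (hermitePoly n)).hasDerivAt x).fun_sub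
    ((hasDerivAt_id x).fun_mul ((hermitePoly n).hasDerivAt x))
  refine (h.fun_mul h2).congr_deriv ?_
  rw [derivative_derivative_hermitePoly]
  simp only [eval_sub, eval_mul, eval_C, eval_X, id]
  ring

theorem tendsto_exp_mul_eval_atTop (p : ℝ[X]) :
    Tendsto (fun x : ℝ => Real.exp (-x ^ 2 / 2) * p.eval x) atTop (𝓝 0) := by
  have h := (p.tendsto_div_exp_atTop.abs).const_mul (Real.exp (1 / 2))
  rw [abs_zero, mul_zero] at h
  refine squeeze_zero_norm (fun x => ?_) h
  rw [norm_mul, Real.norm_eq_abs, Real.norm_eq_abs, Real.abs_exp, abs_div, Real.abs_exp,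
    div_eq_mul_inv |p.eval x|, ← Real.exp_neg]
  have : Real.exp (-x ^ 2 / 2) ≤ Real.exp (1 / 2) * Real.exp (-x) := by
    rw [← Real.exp_add, Real.exp_le_exp]
    nlinarith [sq_nonneg (x - 1)]
  calc _ ≤ Real.exp (1 / 2) * Real.exp (-x) * |p.eval x| :=
        mul_le_mul_of_nonneg_right this (abs_nonneg _)
    _ = _ := by ring

theorem eval_neg_hermitePoly_sq (n : ℕ) (x : ℝ) :
    (hermitePoly n).eval (-x) ^ 2 = (hermitePoly n).eval x ^ 2 := by
  have h := congrArg (eval x) (hermitePoly_comp_neg_X n)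
  simp only [eval_comp, eval_neg, eval_X, eval_mul, eval_C] at h
  rw [h, mul_pow, ← pow_mul, mul_comm n, pow_mul]
  simp

/-- Uniform bound for `exp (-x² / 2) H_n(x)` on the real line. -/
theorem exp_mul_hermitePoly_sq_le {n : ℕ} {μ : ℝ} (hμ : 2 ≤ μ) (hμn : μ ^ 3 = 2 * n + 1) (x : ℝ) :
    (Real.exp (-x ^ 2 / 2) * (hermitePoly n).eval x) ^ 2 * μ ^ 2 ≤ 104 * hermiteEnergy n := by
  wlog hx : 0 ≤ x generalizing x
  · have := this (-x) (by linarith)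
    rw [mul_pow, eval_neg_hermitePoly_sq, neg_sq, ← mul_pow] at this
    exact this
  have hu := hasDerivAt_exp_mul_hermitePoly n
  have hv := hasDerivAt_deriv_exp_mul_hermitePoly n
  rw [← hμn] at hv
  have hin : ∀ y : ℝ, 0 ≤ y → y ^ 2 ≤ μ ^ 3 →
      (Real.exp (-y ^ 2 / 2) * (hermitePoly n).eval y) ^ 2 * μ ^ 2 ≤ 104 * hermiteEnergy n := by
    intro y h0 hy
    have := sq_le_of_oscillator_of_sq_le hμ hu hv h0 hy
    simpa [hermiteEnergy, hμn] using this
  have h3 : 0 ≤ μ ^ 3 := by positivity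
  rcases le_total x √(μ ^ 3) with h | h
  · exact hin x hx ((Real.le_sqrt hx h3).1 h)
  · refine le_trans (mul_le_mul_of_nonneg_right ?_ (sq_nonneg μ))
      (hin _ (Real.sqrt_nonneg _) (Real.sq_sqrt h3).le)
    exact sq_le_of_oscillator_of_le (fun y hy => (Real.sqrt_le_iff.1 hy).2) hu hv
      (tendsto_exp_mul_eval_atTop _) h

/-- The polynomials `Q_n` with `H_n(i s) = i ^ n Q_n(s)`. -/
noncomputable def hermiteImPoly : ℕ → ℝ[X]
  | 0 => 1
  | n + 1 => C 2 * X * hermiteImPoly n + derivative (hermiteImPoly n)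

theorem hermiteImPoly_succ (n : ℕ) :
    hermiteImPoly (n + 1) = C 2 * X * hermiteImPoly n + derivative (hermiteImPoly n) := rfl

theorem derivative_hermiteImPoly_succ (n : ℕ) :
    derivative (hermiteImPoly (n + 1)) = C (2 * ((n : ℝ) + 1)) * hermiteImPoly n := by
  induction n with
  | zero => simp [hermiteImPoly]
  | succ n ih =>
    rw [hermiteImPoly_succ (n + 1)]
    simp only [derivative_add, derivative_mul, derivative_C, derivative_X, ih]
    rw [hermiteImPoly_succ n]
    simp only [map_mul, map_add, map_natCast, map_one, Nat.cast_add, Nat.cast_one]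
    ring

theorem derivative_derivative_hermiteImPoly (n : ℕ) :
    derivative (derivative (hermiteImPoly n)) =
      C (2 * (n : ℝ)) * hermiteImPoly n - C 2 * X * derivative (hermiteImPoly n) := by
  have h := derivative_hermiteImPoly_succ n
  rw [hermiteImPoly_succ n] at h
  simp only [derivative_mul, derivative_C, derivative_X, map_mul, map_add, map_natCast,
    map_one] at h ⊢
  linear_combination h

theorem hermiteImPoly_eval_nonneg (n : ℕ) {s : ℝ} (hs : 0 ≤ s) :
    0 ≤ (hermiteImPoly n).eval s ∧ 0 ≤ (derivative (hermiteImPoly n)).eval s := by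
  induction n with
  | zero => simp [hermiteImPoly]
  | succ n ih =>
    rw [derivative_hermiteImPoly_succ, hermiteImPoly_succ]
    simp only [eval_add, eval_mul, eval_C, eval_X]
    have := ih.1
    have := ih.2
    constructor <;> positivity

theorem hermitePoly_comp_I (n : ℕ) :
    ((hermitePoly n).map (algebraMap ℝ ℂ)).comp (C Complex.I * X) =
      C (Complex.I ^ n) * (hermiteImPoly n).map (algebraMap ℝ ℂ) := by
  induction n with
  | zero => simp [hermitePoly, hermiteImPoly]
  | succ n ih =>
    have hI : C Complex.I * C Complex.I = (-1 : ℂ[X]) := by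
      rw [← C_mul, Complex.I_mul_I]; simp
    have hd : (derivative ((hermitePoly n).map (algebraMap ℝ ℂ))).comp (C Complex.I * X) =
        - (C Complex.I * C (Complex.I ^ n) *
          derivative ((hermiteImPoly n).map (algebraMap ℝ ℂ))) := by
      have h := congrArg derivative ih
      rw [derivative_comp] at h
      simp only [derivative_X, derivative_mul, derivative_C] at h
      linear_combination (-C Complex.I) * h +
        (derivative ((hermitePoly n).map (algebraMap ℝ ℂ))).comp (C Complex.I * X) * hI
    rw [hermitePoly_succ, hermiteImPoly_succ]
    simp only [Polynomial.map_sub, Polynomial.map_add, Polynomial.map_mul, map_C, map_X,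
      ← derivative_map, sub_comp, mul_comp, C_comp, X_comp, ih, hd, pow_succ, map_mul]
    ring

theorem norm_hermiteC_mul_I (n : ℕ) (s : ℝ) :
    ‖hermiteC n (s * Complex.I)‖ = |(hermiteImPoly n).eval s| := by
  have h := congrArg (eval (s : ℂ)) (hermitePoly_comp_I n)
  simp only [eval_comp, eval_mul, eval_C, eval_X] at h
  have h1 : hermiteC n (s * Complex.I) = Complex.I ^ n * ((hermiteImPoly n).eval s : ℝ) := by
    rw [hermiteC, aeval_def, ← eval_map, mul_comm, h, eval_map]
    congr 1
    exact (aeval_algebraMap_apply ℂ s (hermiteImPoly n)).trans (by simp)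
  rw [h1, norm_mul, norm_pow, Complex.norm_I, one_pow, one_mul, Complex.norm_real,
    Real.norm_eq_abs]

theorem eval_zero_hermiteImPoly_sq (n : ℕ) :
    (hermiteImPoly n).eval 0 ^ 2 = (hermitePoly n).eval 0 ^ 2 := by
  have h := norm_hermiteC_mul_I n 0
  have h0 := hermiteC_ofReal n 0
  rw [Complex.ofReal_zero, zero_mul] at h
  rw [Complex.ofReal_zero, hermiteH_eq_eval] at h0
  rw [h0, Complex.norm_real, Real.norm_eq_abs] at h
  rw [← sq_abs, ← h, sq_abs]

theorem hermiteEnergy_eq_hermiteImPoly (n : ℕ) :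
    hermiteEnergy n = (2 * n + 1) * (hermiteImPoly n).eval 0 ^ 2 +
      (derivative (hermiteImPoly n)).eval 0 ^ 2 := by
  rw [hermiteEnergy, eval_zero_hermiteImPoly_sq]
  cases n with
  | zero => simp [hermitePoly, hermiteImPoly]
  | succ n =>
    rw [derivative_hermitePoly_succ, derivative_hermiteImPoly_succ, eval_mul, eval_mul, mul_pow,
      mul_pow, eval_zero_hermiteImPoly_sq]

/-- Growth of `H_n` along the imaginary axis. -/
theorem sqrt_hermiteEnergy_mul_sinh_le (n : ℕ) {ρ : ℝ} (hρ : 0 ≤ ρ) :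
    √(hermiteEnergy n) * Real.sinh (√(2 * n + 1) * ρ) ≤
      √(2 * n + 1) * (Real.exp (ρ ^ 2 / 2) * ‖hermiteC n (ρ * Complex.I)‖) := by
  have hk2 : √(2 * (n : ℝ) + 1) ^ 2 = 2 * n + 1 := Real.sq_sqrt (by positivity)
  have he : ∀ s : ℝ, HasDerivAt (fun s : ℝ => Real.exp (s ^ 2 / 2)) (Real.exp (s ^ 2 / 2) * s) s :=
    fun s => (((hasDerivAt_pow 2 s).div_const 2).exp).congr_deriv (by simp)
  have hw : ∀ s : ℝ, HasDerivAt (fun s : ℝ => Real.exp (s ^ 2 / 2) * (hermiteImPoly n).eval s)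
      (Real.exp (s ^ 2 / 2) *
        ((derivative (hermiteImPoly n)).eval s + s * (hermiteImPoly n).eval s)) s := fun s =>
    ((he s).fun_mul ((hermiteImPoly n).hasDerivAt s)).congr_deriv (by ring)
  have hv : ∀ s : ℝ, HasDerivAt (fun s : ℝ => Real.exp (s ^ 2 / 2) *
        ((derivative (hermiteImPoly n)).eval s + s * (hermiteImPoly n).eval s))
      ((√(2 * n + 1) ^ 2 + s ^ 2) * (Real.exp (s ^ 2 / 2) * (hermiteImPoly n).eval s)) s := by
    intro s
    refine ((he s).fun_mul (((derivative (hermiteImPoly n)).hasDerivAt s).fun_add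
      ((hasDerivAt_id s).fun_mul ((hermiteImPoly n).hasDerivAt s)))).congr_deriv ?_
    rw [derivative_derivative_hermiteImPoly, hk2]
    simp only [eval_sub, eval_mul, eval_C, eval_X, id]
    ring
  have h := sinh_le_of_deriv_deriv_eq (Real.sqrt_pos.2 (by positivity : 0 < 2 * (n : ℝ) + 1)) hw hv
    (fun s hs => mul_nonneg (Real.exp_pos _).le (hermiteImPoly_eval_nonneg n hs).1)
    (by simpa using (hermiteImPoly_eval_nonneg n le_rfl).2) hρ
  rw [norm_hermiteC_mul_I, abs_of_nonneg (hermiteImPoly_eval_nonneg n hρ).1]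
  rw [hk2] at h
  simpa [hermiteEnergy_eq_hermiteImPoly] using h

/-- On the real line `exp (-x² / 2) H_n(x)` is smaller than the value of `H_n` at `i ρ` by a factor
of the order `n ^ (1 / 6) exp (-ρ √(2 n + 1))`. -/
theorem exp_mul_hermitePoly_mul_sinh_le {n : ℕ} {μ ρ : ℝ} (hμ : 2 ≤ μ) (hμn : μ ^ 3 = 2 * n + 1)
    (hρ : 0 ≤ ρ) (x : ℝ) :
    Real.exp (-x ^ 2 / 2) * |(hermitePoly n).eval x| * Real.sinh (√(2 * n + 1) * ρ) ≤
      11 * Real.exp (ρ ^ 2 / 2) * √μ * ‖hermiteC n (ρ * Complex.I)‖ := by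
  have hμ0 : 0 < μ := by linarith
  have h1 : Real.exp (-x ^ 2 / 2) * |(hermitePoly n).eval x| * μ ≤ 11 * √(hermiteEnergy n) := by
    refine abs_le_of_sq_le_sq' ?_ (by positivity) |>.2
    rw [mul_pow, mul_pow, sq_abs, mul_pow, Real.sq_sqrt (hermiteEnergy_nonneg n), ← mul_pow]
    linarith [exp_mul_hermitePoly_sq_le hμ hμn x, hermiteEnergy_nonneg n]
  have hsq : √(2 * (n : ℝ) + 1) = √μ * μ := by
    rw [← hμn, Real.sqrt_eq_iff_mul_self_eq (by positivity) (by positivity)]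
    rw [mul_mul_mul_comm, Real.mul_self_sqrt hμ0.le]
    ring
  have h2 := sqrt_hermiteEnergy_mul_sinh_le n hρ
  have hs : 0 ≤ Real.sinh (√(2 * n + 1) * ρ) := Real.sinh_nonneg_iff.2 (by positivity)
  refine le_of_mul_le_mul_right ?_ hμ0
  calc _ = Real.exp (-x ^ 2 / 2) * |(hermitePoly n).eval x| * μ *
        Real.sinh (√(2 * n + 1) * ρ) := by ring
    _ ≤ 11 * √(hermiteEnergy n) * Real.sinh (√(2 * n + 1) * ρ) :=
        mul_le_mul_of_nonneg_right h1 hs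
    _ ≤ 11 * (√(2 * n + 1) * (Real.exp (ρ ^ 2 / 2) * ‖hermiteC n (ρ * Complex.I)‖)) := by
        rw [mul_assoc]; exact mul_le_mul_of_nonneg_left h2 (by norm_num)
    _ = _ := by rw [hsq]; ring

end HermiteBounds

/-! ### Growth of Hermite polynomials along horizontal lines -/

section LineGrowth

open Polynomial

/-- The logarithmic derivative `H_n' / H_n` off the real axis. -/
noncomputable def hermiteLogDeriv (n : ℕ) (z : ℂ) : ℂ :=
  ∑ x ∈ hermiteZeros n, (z - (x : ℂ))⁻¹

theorem sub_ofReal_ne_zero {z : ℂ} (hz : z.im ≠ 0) (x : ℝ) : z - (x : ℂ) ≠ 0 := by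
  intro h
  apply hz
  rw [sub_eq_zero.1 h, Complex.ofReal_im]

theorem hasDerivAt_hermiteC_mul_logDeriv (n : ℕ) {z : ℂ} (hz : z.im ≠ 0) :
    HasDerivAt (hermiteC n) (hermiteC n z * hermiteLogDeriv n z) z := by
  classical
  have h : HasDerivAt (fun z : ℂ => 2 ^ n * ∏ x ∈ hermiteZeros n, (z - (x : ℂ)))
      (2 ^ n * ∑ x ∈ hermiteZeros n, (∏ y ∈ (hermiteZeros n).erase x, (z - (y : ℂ))) • (1 : ℂ)) z :=
    (HasDerivAt.fun_finsetProd (f := fun (x : ℝ) (z : ℂ) => z - (x : ℂ)) (f' := fun _ => 1)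
      fun x _ => (hasDerivAt_id z).sub_const (x : ℂ)).const_mul _
  have hfun : hermiteC n = fun z : ℂ => 2 ^ n * ∏ x ∈ hermiteZeros n, (z - (x : ℂ)) :=
    funext (hermiteC_eq_prod n)
  rw [hfun]
  refine h.congr_deriv ?_
  rw [mul_assoc]
  congr 1
  rw [hermiteLogDeriv, Finset.mul_sum]
  refine Finset.sum_congr rfl fun x hx => ?_
  rw [smul_eq_mul, mul_one, ← Finset.mul_prod_erase _ _ hx,
    eq_mul_inv_iff_mul_eq₀ (sub_ofReal_ne_zero hz x), mul_comm]

/-- The Riccati equation of the logarithmic derivative, together with the bound of its derivative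
`-∑ (z - x)⁻²` by its imaginary part. -/
theorem hermiteLogDeriv_riccati (n : ℕ) {z : ℂ} (hz : 0 < z.im) :
    ∃ g : ℂ, (hermiteLogDeriv n z - z) ^ 2 = z ^ 2 - 2 * n - g ∧
      ‖g‖ * z.im ≤ -(hermiteLogDeriv n z).im := by
  have hG : HasDerivAt (hermiteLogDeriv n)
      (∑ x ∈ hermiteZeros n, -1 / (z - (x : ℂ)) ^ 2) z :=
    HasDerivAt.fun_sum fun x _ =>
      ((hasDerivAt_id z).sub_const (x : ℂ)).fun_inv (sub_ofReal_ne_zero hz.ne' x)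
  set g := ∑ x ∈ hermiteZeros n, -1 / (z - (x : ℂ)) ^ 2
  refine ⟨g, ?_, ?_⟩
  · have h1 := (hasDerivAt_hermiteC_mul_logDeriv n hz.ne').fun_mul hG
    have hev : (fun z => aeval z (derivative (hermitePoly n))) =ᶠ[𝓝 z]
        fun z => hermiteC n z * hermiteLogDeriv n z := by
      filter_upwards [(isOpen_lt continuous_const Complex.continuous_im).mem_nhds hz] with w hw
      exact (hasDerivAt_hermiteC n w).unique (hasDerivAt_hermiteC_mul_logDeriv n (ne_of_gt hw))
    have h2 := ((derivative (hermitePoly n)).hasDerivAt_aeval z).unique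
      (h1.congr_of_eventuallyEq hev)
    rw [derivative_derivative_hermitePoly] at h2
    have h3 : aeval z (derivative (hermitePoly n)) = hermiteC n z * hermiteLogDeriv n z :=
      hev.self_of_nhds
    have h4 : aeval z (hermitePoly n) = hermiteC n z := rfl
    simp only [map_sub, map_mul, aeval_C, aeval_X, h3, h4] at h2
    simp only [map_natCast, map_ofNat] at h2
    refine mul_left_cancel₀ (hermiteC_ne_zero n hz.ne') ?_
    linear_combination -h2
  · have him : (hermiteLogDeriv n z).im =
        -(∑ x ∈ hermiteZeros n, (Complex.normSq (z - (x : ℂ)))⁻¹) * z.im := by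
      rw [hermiteLogDeriv, Complex.im_sum, neg_mul, Finset.sum_mul, ← Finset.sum_neg_distrib]
      refine Finset.sum_congr rfl fun x _ => ?_
      rw [Complex.inv_im, Complex.sub_im, Complex.ofReal_im, sub_zero]
      ring
    rw [him, neg_mul, neg_neg]
    refine mul_le_mul_of_nonneg_right ((norm_sum_le _ _).trans (le_of_eq ?_)) hz.le
    refine Finset.sum_congr rfl fun x _ => ?_
    rw [norm_div, norm_neg, norm_one, norm_pow, Complex.normSq_eq_norm_sq, one_div]

/-- A lower bound for the real part of a solution `G` of the Riccati equation, obtained by reading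
the equation as a quadratic one for `G - z` with the error `g`. If `-Im G` is at least `Im z`, then
the imaginary part of that equation bounds `Re z - Re G` by `Re z / 2 + 1 / (2 Im z)`; otherwise
`|g| ≤ 1` and the real part of the equation suffices. -/
theorem min_le_re_of_riccati {G g z : ℂ} {N : ℝ} (hN : 3 * z.im ^ 2 + 1 ≤ N) (hρ : 0 < z.im)
    (ht : 0 < z.re) (hG : (G - z) ^ 2 = z ^ 2 - 2 * N - g) (hg : ‖g‖ * z.im ≤ -G.im) :
    min (z.re / 2 - 1 / (2 * z.im)) (N / (2 * z.re)) ≤ G.re := by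
  obtain ⟨A, B⟩ := G
  obtain ⟨t, ρ⟩ := z
  simp only at hρ ht hN hg ⊢
  have hre := congrArg Complex.re hG
  have him := congrArg Complex.im hG
  simp only [sq, Complex.mul_re, Complex.mul_im, Complex.sub_re, Complex.sub_im, Complex.re_ofNat,
    Complex.im_ofNat, Complex.ofReal_re, Complex.ofReal_im, mul_zero, sub_zero,
    zero_mul, add_zero] at hre him
  have hgre := (abs_le.1 (Complex.abs_re_le_norm g)).1
  have hgim := (abs_le.1 (Complex.abs_im_le_norm g)).1
  rcases le_total (2 * ρ) (ρ - B) with h | h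
  · refine (min_le_left _ _).trans ?_
    -- The imaginary part of the equation bounds `t - A`.
    have h1 : 2 * (t - A) * (ρ - B) ≤ 2 * t * ρ + ‖g‖ := by nlinarith
    have h2 : (t - A) * (ρ - B) * (2 * ρ) ≤ (t * ρ + 1) * (ρ - B) := by
      nlinarith [mul_le_mul_of_nonneg_right h1 hρ.le,
        mul_nonneg (mul_nonneg ht.le hρ.le) (by linarith : 0 ≤ -B - ρ)]
    have h3 : (t - A) * (2 * ρ) ≤ t * ρ + 1 := by
      refine le_of_mul_le_mul_right ?_ (by linarith : 0 < ρ - B)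
      linarith
    have h4 : t / 2 - 1 / (2 * ρ) = t - (t * ρ + 1) / (2 * ρ) := by field_simp; ring
    rw [h4]
    have := (le_div_iff₀ (by positivity : 0 < 2 * ρ)).2 h3
    linarith
  · refine (min_le_right _ _).trans ?_
    -- The real part of the equation gives `(t - A)² ≤ t² - N`.
    have hg1 : ‖g‖ ≤ 1 := by
      refine le_of_mul_le_mul_right ?_ hρ
      linarith
    have hB : 0 ≤ -B := le_trans (by positivity) hg
    have h1 : (t - A) ^ 2 ≤ t ^ 2 - N := by nlinarith
    have hNt : N ≤ t ^ 2 := by nlinarith [sq_nonneg (t - A)]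
    have hd : N / (2 * t) * (2 * t) = N := by field_simp
    have h2 : t - A ≤ t - N / (2 * t) := by
      refine abs_le_of_sq_le_sq' ?_ ?_ |>.2
      · nlinarith [sq_nonneg (N / (2 * t))]
      · rw [sub_nonneg, div_le_iff₀ (by positivity)]
        nlinarith
    linarith

theorem hasDerivAt_log_norm_hermiteC_sq (n : ℕ) {ρ : ℝ} (hρ : 0 < ρ) (t : ℝ) :
    HasDerivAt (fun t : ℝ => Real.log (‖hermiteC n (t + ρ * Complex.I)‖ ^ 2))
      (2 * (hermiteLogDeriv n (t + ρ * Complex.I)).re) t := by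
  have him : ((t : ℂ) + ρ * Complex.I).im = ρ := by simp
  have hz : ((t : ℂ) + ρ * Complex.I).im ≠ 0 := by rw [him]; exact hρ.ne'
  have h1 : HasDerivAt (fun t : ℝ => hermiteC n (t + ρ * Complex.I))
      (hermiteC n (t + ρ * Complex.I) * hermiteLogDeriv n (t + ρ * Complex.I)) t := by
    have := (hasDerivAt_hermiteC_mul_logDeriv n hz).comp (t : ℂ)
      ((hasDerivAt_id (t : ℂ)).add_const (ρ * Complex.I))
    simpa using this.comp_ofReal
  have hne := hermiteC_ne_zero n hz
  have hpos : ‖hermiteC n (t + ρ * Complex.I)‖ ^ 2 ≠ 0 := by simpa using hne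
  refine (h1.norm_sq.log hpos).congr_deriv ?_
  rw [div_eq_iff hpos, Complex.inner, mul_right_comm, Complex.mul_conj']
  norm_cast
  rw [Complex.re_ofReal_mul]
  ring

/-- Along the line `Im z = ρ` the polynomial `H_n` grows at least like any prescribed power of
`1 + t²`, with a constant that does not depend on `n`. -/
theorem exists_mul_norm_hermiteC_le {ρ : ℝ} (hρ : 0 < ρ) (k : ℕ) :
    ∃ c : ℝ, 0 < c ∧ ∀ n : ℕ, 3 * ρ ^ 2 + 1 ≤ n → 4 * k ≤ n → ∀ t : ℝ,
      c * (1 + t ^ 2) ^ k * ‖hermiteC n (ρ * Complex.I)‖ ≤ ‖hermiteC n (t + ρ * Complex.I)‖ := by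
  -- Beyond `τ` the bound for the real part of the logarithmic derivative exceeds `2 k / t`.
  set τ : ℝ := 1 / ρ + 4 * k + 1
  have hτ0 : 1 ≤ τ := by
    have : 0 ≤ 1 / ρ := by positivity
    have : (0 : ℝ) ≤ k := by positivity
    linarith
  set b : ℝ := 1 / ρ + 2 * k
  have hb : 0 ≤ b := by positivity
  refine ⟨Real.exp (-(b * τ) / 2), Real.exp_pos _, fun n hn hk t => ?_⟩
  wlog ht0 : 0 ≤ t generalizing t
  · have := this (-t) (by linarith)
    rw [neg_sq] at this
    have hz : ((-t : ℝ) : ℂ) + ρ * Complex.I = -(starRingEnd ℂ (t + ρ * Complex.I)) := by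
      simp [add_comm]
    rw [hz, hermiteC_neg, norm_mul, norm_hermiteC_conj] at this
    simpa using this
  have hk' : 4 * (k : ℝ) ≤ n := by exact_mod_cast hk
  set L : ℝ → ℝ := fun t => Real.log (‖hermiteC n (t + ρ * Complex.I)‖ ^ 2)
    - 2 * k * Real.log (1 + t ^ 2)
  have hd : ∀ t : ℝ, HasDerivAt L (2 * (hermiteLogDeriv n (t + ρ * Complex.I)).re
      - 2 * k * (2 * t / (1 + t ^ 2))) t := fun t => by
    have h1 : HasDerivAt (fun t : ℝ => 1 + t ^ 2) (2 * t) t := by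
      simpa using (hasDerivAt_pow 2 t).const_add 1
    exact (hasDerivAt_log_norm_hermiteC_sq n hρ t).fun_sub
      ((h1.log (by positivity)).const_mul (2 * (k : ℝ)))
  have hA : ∀ t : ℝ, 0 < t → min (t / 2 - 1 / (2 * ρ)) (n / (2 * t)) ≤
      (hermiteLogDeriv n (t + ρ * Complex.I)).re := by
    intro t ht
    have him : ((t : ℂ) + ρ * Complex.I).im = ρ := by simp
    have hre : ((t : ℂ) + ρ * Complex.I).re = t := by simp
    obtain ⟨g, h1, h2⟩ := hermiteLogDeriv_riccati n (z := t + ρ * Complex.I) (by rw [him]; exact hρ)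
    have := min_le_re_of_riccati (N := n) (by rw [him]; exact hn) (by rw [him]; exact hρ)
      (by rw [hre]; exact ht) (by exact_mod_cast h1) h2
    rwa [him, hre] at this
  have hfrac : ∀ t : ℝ, 0 < t → 2 * t / (1 + t ^ 2) ≤ 1 ∧ 2 * t / (1 + t ^ 2) ≤ 2 / t := by
    intro t ht
    constructor
    · rw [div_le_one (by positivity)]; nlinarith [sq_nonneg (t - 1)]
    · rw [div_le_div_iff₀ (by positivity) ht]; nlinarith
  have hk0 : (0 : ℝ) ≤ k := by positivity
  -- `L` decreases at rate at most `b`, and it increases beyond `τ`.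
  have hL1 : ∀ t : ℝ, 0 < t → 0 ≤ 2 * (hermiteLogDeriv n (t + ρ * Complex.I)).re
      - 2 * k * (2 * t / (1 + t ^ 2)) + b := by
    intro t ht
    have h1 : -(1 / (2 * ρ)) ≤ min (t / 2 - 1 / (2 * ρ)) (n / (2 * t)) := by
      refine le_min (by linarith) ?_
      have h2 : 0 ≤ 1 / (2 * ρ) := by positivity
      have h3 : 0 ≤ (n : ℝ) / (2 * t) := by positivity
      linarith
    have h2 := h1.trans (hA t ht)
    have h3 := mul_le_mul_of_nonneg_left (hfrac t ht).1 (by positivity : 0 ≤ 2 * (k : ℝ))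
    have h4 : 1 / ρ = 2 * (1 / (2 * ρ)) := by field_simp
    linarith
  have hL2 : ∀ t : ℝ, τ ≤ t → 0 ≤ 2 * (hermiteLogDeriv n (t + ρ * Complex.I)).re
      - 2 * k * (2 * t / (1 + t ^ 2)) := by
    intro t ht
    have ht0 : 0 < t := by linarith
    have hkt : 2 * k / t ≤ 2 * k := div_le_self (by positivity) (by linarith)
    have h1 : 2 * k / t ≤ min (t / 2 - 1 / (2 * ρ)) (n / (2 * t)) := by
      refine le_min ?_ ?_
      · have h4 : 1 / ρ = 2 * (1 / (2 * ρ)) := by field_simp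
        linarith
      · rw [div_le_div_iff₀ ht0 (by positivity)]
        nlinarith
    have h2 := h1.trans (hA t ht0)
    have h3 := mul_le_mul_of_nonneg_left (hfrac t ht0).2 (by positivity : 0 ≤ 2 * (k : ℝ))
    have h4 : 2 * k * (2 / t) = 2 * (2 * k / t) := by ring
    linarith
  have hm1 : MonotoneOn (fun t => L t + b * t) (Set.Ici 0) := by
    have hd' : ∀ t : ℝ, HasDerivAt (fun t => L t + b * t) (2 * (hermiteLogDeriv n
        (t + ρ * Complex.I)).re - 2 * k * (2 * t / (1 + t ^ 2)) + b) t := fun t => by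
      simpa using (hd t).fun_add ((hasDerivAt_id t).const_mul b)
    refine monotoneOn_of_deriv_nonneg (convex_Ici 0)
      (fun y _ => (hd' y).continuousAt.continuousWithinAt)
      (fun y _ => (hd' y).differentiableAt.differentiableWithinAt) fun y hy => ?_
    rw [interior_Ici] at hy
    rw [(hd' y).deriv]
    exact hL1 y hy
  have hm2 : MonotoneOn L (Set.Ici τ) := by
    refine monotoneOn_of_deriv_nonneg (convex_Ici τ)
      (fun y _ => (hd y).continuousAt.continuousWithinAt)
      (fun y _ => (hd y).differentiableAt.differentiableWithinAt) fun y hy => ?_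
    rw [(hd y).deriv]
    exact hL2 y (interior_subset hy)
  have hLt : L 0 - b * τ ≤ L t := by
    have hle : ∀ s, 0 ≤ s → s ≤ τ → L 0 - b * τ ≤ L s := fun s h0 hs => by
      have h1 := hm1 (Set.mem_Ici.2 le_rfl) (Set.mem_Ici.2 h0) h0
      have h2 := mul_le_mul_of_nonneg_left hs hb
      simp only [mul_zero, add_zero] at h1
      linarith
    rcases le_total t τ with h | h
    · exact hle t ht0 h
    · exact (hle τ (by linarith) le_rfl).trans (hm2 (Set.mem_Ici.2 le_rfl) (Set.mem_Ici.2 h) h)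
  have hpos : ∀ s : ℝ, 0 < ‖hermiteC n (s + ρ * Complex.I)‖ := fun s =>
    norm_pos_iff.2 (hermiteC_ne_zero n (by simpa using hρ.ne'))
  have h0 := hpos 0
  simp only [Complex.ofReal_zero, zero_add] at h0
  simp only [L, Complex.ofReal_zero, zero_add, Real.log_pow] at hLt
  simp only [ne_eq, OfNat.ofNat_ne_zero, not_false_eq_true, zero_pow, add_zero, Real.log_one,
    mul_zero, sub_zero, Nat.cast_ofNat] at hLt
  rw [← Real.log_le_log_iff (by positivity) (hpos t), Real.log_mul (by positivity) h0.ne',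
    Real.log_mul (by positivity) (by positivity), Real.log_exp, Real.log_pow]
  linarith

end LineGrowth

/-! ### Residues in a strip -/

section StripResidues

open Complex

/-- Approach to infinity inside the closed strip. -/
def stripAtInfty (ρ : ℝ) : Filter ℂ := comap (fun z : ℂ => |z.re|) atTop ⊓ 𝓟 (closedStrip ρ)

theorem eventually_stripAtInfty {ρ : ℝ} {p : ℂ → Prop} :
    (∀ᶠ z in stripAtInfty ρ, p z) ↔ ∃ T : ℝ, ∀ z ∈ closedStrip ρ, T ≤ |z.re| → p z := by
  rw [stripAtInfty, eventually_inf_principal, (atTop_basis.comap _).eventually_iff]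
  constructor
  · rintro ⟨T, -, h⟩
    exact ⟨T, fun z hz hT => h (by simpa using hT) hz⟩
  · rintro ⟨T, h⟩
    exact ⟨T, trivial, fun z hz hT => h z hT (by simpa using hz)⟩

theorem tendsto_abs_re_stripAtInfty (ρ : ℝ) :
    Tendsto (fun z : ℂ => |z.re|) (stripAtInfty ρ) atTop :=
  tendsto_comap.mono_left inf_le_left

theorem abs_re_sub_le_norm (z : ℂ) (y : ℝ) : |z.re| - |y| ≤ ‖z - y‖ := by
  have h := abs_re_le_norm (z - y)
  rw [sub_re, ofReal_re] at h
  exact (abs_sub_abs_le_abs_sub _ _).trans h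

theorem tendsto_inv_sub_stripAtInfty (ρ y : ℝ) :
    Tendsto (fun z : ℂ => (z - (y : ℂ))⁻¹) (stripAtInfty ρ) (𝓝 0) := by
  refine tendsto_inv₀_cobounded.comp (tendsto_norm_atTop_iff_cobounded.1 ?_)
  exact tendsto_atTop_mono (fun z => abs_re_sub_le_norm z y)
    (tendsto_atTop_add_const_right _ _ (tendsto_abs_re_stripAtInfty ρ))

/-- Partial fractions of the reciprocal of a nodal polynomial. -/
theorem inv_nodal_eq_sum (Y : Finset ℝ) (hY : Y.Nonempty) {z : ℂ} (hz : ∀ y ∈ Y, z ≠ (y : ℂ)) :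
    (∏ y ∈ Y, (z - (y : ℂ)))⁻¹ =
      ∑ y ∈ Y, Lagrange.nodalWeight Y (fun y : ℝ => (y : ℂ)) y * (z - (y : ℂ))⁻¹ := by
  classical
  have hinj : Set.InjOn (fun y : ℝ => (y : ℂ)) Y := ofReal_injective.injOn
  have h := Lagrange.eval_interpolate_not_at_node (s := Y) (v := fun y : ℝ => (y : ℂ)) (x := z) 1 hz
  rw [Lagrange.interpolate_one hinj hY, Polynomial.eval_one, Lagrange.eval_nodal] at h
  simp only [Pi.one_apply, mul_one] at h
  exact inv_eq_of_mul_eq_one_right h.symm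

/-- The quotient `F / ∏ (z - y)` without its principal parts. Written through `dslope`, for analytic `F`
it is differentiable at the nodes as well, which takes care of the removable singularities. -/
noncomputable def regularPart (F : ℂ → ℂ) (Y : Finset ℝ) (z : ℂ) : ℂ :=
  ∑ y ∈ Y, Lagrange.nodalWeight Y (fun y : ℝ => (y : ℂ)) y * dslope F y z

theorem regularPart_eq (F : ℂ → ℂ) (Y : Finset ℝ) (hY : Y.Nonempty) {z : ℂ}
    (hz : ∀ y ∈ Y, z ≠ (y : ℂ)) :
    regularPart F Y z = F z / ∏ y ∈ Y, (z - (y : ℂ)) -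
      ∑ y ∈ Y, Lagrange.nodalWeight Y (fun y : ℝ => (y : ℂ)) y * F y * (z - (y : ℂ))⁻¹ := by
  rw [div_eq_mul_inv, inv_nodal_eq_sum Y hY hz, Finset.mul_sum, ← Finset.sum_sub_distrib,
    regularPart]
  refine Finset.sum_congr rfl fun y hy => ?_
  rw [dslope_of_ne _ (hz y hy), slope_def_field]
  ring

theorem ofReal_mem_closedStrip {ρ : ℝ} (hρ : 0 < ρ) (y : ℝ) : (y : ℂ) ∈ closedStrip ρ := by
  simp [closedStrip, hρ.le]

theorem differentiableOn_regularPart {F : ℂ → ℂ} {ρ : ℝ} (hρ : 0 < ρ)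
    (hF : AnalyticOnNhd ℂ F (closedStrip ρ)) (Y : Finset ℝ) :
    DifferentiableOn ℂ (regularPart F Y) (closedStrip ρ) := by
  have hU : IsOpen {z | AnalyticAt ℂ F z} := isOpen_analyticAt ℂ F
  have hFU : DifferentiableOn ℂ F {z | AnalyticAt ℂ F z} := fun z hz =>
    hz.differentiableAt.differentiableWithinAt
  refine DifferentiableOn.mono ?_ (show closedStrip ρ ⊆ {z | AnalyticAt ℂ F z} from hF)
  refine DifferentiableOn.fun_sum fun y _ => DifferentiableOn.const_mul ?_ _
  exact (differentiableOn_dslope (hU.mem_nhds (hF _ (ofReal_mem_closedStrip hρ y)))).2 hFU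

theorem integrable_and_integral_div_sub_sq_add_sq {ρ : ℝ} (hρ : 0 < ρ) (y : ℝ) :
    Integrable (fun t : ℝ => ρ / ((t - y) ^ 2 + ρ ^ 2)) ∧
      ∫ t : ℝ, ρ / ((t - y) ^ 2 + ρ ^ 2) = Real.pi := by
  have h : (fun t : ℝ => ρ / ((t - y) ^ 2 + ρ ^ 2)) =
      fun t : ℝ => ρ⁻¹ * (1 + ((t - y) / ρ) ^ 2)⁻¹ := by
    funext t
    field_simp
    ring
  rw [h]
  refine ⟨((integrable_inv_one_add_sq.comp_div hρ.ne').comp_sub_right y).const_mul _, ?_⟩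
  rw [integral_const_mul,
    integral_sub_right_eq_self (fun t : ℝ => (1 + (t / ρ) ^ 2)⁻¹) y,
    Measure.integral_comp_div (fun t : ℝ => (1 + t ^ 2)⁻¹) ρ, integral_univ_inv_one_add_sq,
    abs_of_pos hρ, smul_eq_mul, ← mul_assoc, inv_mul_cancel₀ hρ.ne', one_mul]

theorem inv_line_sub_inv_line {ρ : ℝ} (hρ : 0 < ρ) (t y : ℝ) :
    ((t : ℂ) - ρ * I - y)⁻¹ - ((t : ℂ) + ρ * I - y)⁻¹ =
      2 * I * ((ρ / ((t - y) ^ 2 + ρ ^ 2) : ℝ) : ℂ) := by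
  have h1 : (t : ℂ) - ρ * I - y ≠ 0 := sub_ofReal_ne_zero (by simpa using hρ.ne') y
  have h2 : (t : ℂ) + ρ * I - y ≠ 0 := sub_ofReal_ne_zero (by simpa using hρ.ne') y
  have h3 : ((t : ℂ) - y) ^ 2 + ρ ^ 2 = ((t : ℂ) - ρ * I - y) * ((t : ℂ) + ρ * I - y) := by
    linear_combination (ρ : ℂ) ^ 2 * I_sq
  push_cast
  rw [h3]
  field_simp
  ring

theorem add_mul_I_mem_closedStrip {ρ s : ℝ} (hs : |s| ≤ ρ) (t : ℝ) :
    (t : ℂ) + s * I ∈ closedStrip ρ := by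
  have := abs_le.1 hs
  simp [closedStrip, this.1, this.2]

/-- The residue theorem for the two boundary lines of the strip and the function
`F / ∏ (z - y)`. -/
theorem integral_line_sub_integral_line {F : ℂ → ℂ} {ρ : ℝ} (hρ : 0 < ρ)
    (hF : AnalyticOnNhd ℂ F (closedStrip ρ)) (Y : Finset ℝ) (hY : Y.Nonempty)
    (hlim : Tendsto (fun z => F z / ∏ y ∈ Y, (z - (y : ℂ))) (stripAtInfty ρ) (𝓝 0))
    (hlo : Integrable fun t : ℝ => F (t - ρ * I) / ∏ y ∈ Y, ((t : ℂ) - ρ * I - (y : ℂ)))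
    (hup : Integrable fun t : ℝ => F (t + ρ * I) / ∏ y ∈ Y, ((t : ℂ) + ρ * I - (y : ℂ))) :
    (∫ t : ℝ, F (t - ρ * I) / ∏ y ∈ Y, ((t : ℂ) - ρ * I - (y : ℂ))) -
        ∫ t : ℝ, F (t + ρ * I) / ∏ y ∈ Y, ((t : ℂ) + ρ * I - (y : ℂ)) =
      2 * Real.pi * I * ∑ y ∈ Y, Lagrange.nodalWeight Y (fun y : ℝ => (y : ℂ)) y * F y := by
  set D := regularPart F Y
  have hD := differentiableOn_regularPart hρ hF Y
  have hDlim : Tendsto D (stripAtInfty ρ) (𝓝 0) := by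
    have h : Tendsto (fun z => F z / ∏ y ∈ Y, (z - (y : ℂ)) -
        ∑ y ∈ Y, Lagrange.nodalWeight Y (fun y : ℝ => (y : ℂ)) y * F y * (z - (y : ℂ))⁻¹)
        (stripAtInfty ρ) (𝓝 0) := by
      have hs := tendsto_finsetSum Y fun y _ => (tendsto_inv_sub_stripAtInfty ρ y).const_mul
        (Lagrange.nodalWeight Y (fun y : ℝ => (y : ℂ)) y * F y)
      simpa using hlim.sub hs
    refine h.congr' ?_
    have hev : ∀ᶠ z in stripAtInfty ρ, ∀ y ∈ Y, z ≠ (y : ℂ) := by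
      rw [Finset.eventually_all]
      intro y _
      filter_upwards [(tendsto_abs_re_stripAtInfty ρ).eventually_gt_atTop |y|] with z hz h
      rw [h, ofReal_re] at hz
      exact lt_irrefl _ hz
    filter_upwards [hev] with z hz
    exact (regularPart_eq F Y hY hz).symm
  have hcont : ∀ s : ℝ, |s| ≤ ρ → Continuous fun t : ℝ => D (t + s * I) := fun s hs =>
    hD.continuousOn.comp_continuous (by fun_prop) fun t => add_mul_I_mem_closedStrip hs t
  have hρabs : |ρ| ≤ ρ := (abs_of_pos hρ).le
  have hρabs' : |-ρ| ≤ ρ := by rw [abs_neg]; exact hρabs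
  have hclo : Continuous fun t : ℝ => D (t - ρ * I) := by
    simpa [sub_eq_add_neg] using hcont (-ρ) hρabs'
  have hcup : Continuous fun t : ℝ => D (t + ρ * I) := hcont ρ hρabs
  -- On the boundary the principal parts contribute an integrable difference.
  set c : ℝ → ℂ := fun y => Lagrange.nodalWeight Y (fun y : ℝ => (y : ℂ)) y * F y with hc
  have hdiff : ∀ t : ℝ, D (t - ρ * I) - D (t + ρ * I) =
      F (t - ρ * I) / (∏ y ∈ Y, ((t : ℂ) - ρ * I - (y : ℂ))) -
        F (t + ρ * I) / (∏ y ∈ Y, ((t : ℂ) + ρ * I - (y : ℂ))) -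
        ∑ y ∈ Y, c y * (2 * I * ((ρ / ((t - y) ^ 2 + ρ ^ 2) : ℝ) : ℂ)) := by
    intro t
    have h1 : ∀ y ∈ Y, (t : ℂ) - ρ * I ≠ (y : ℂ) := fun y _ =>
      sub_ne_zero.1 (sub_ofReal_ne_zero (by simpa using hρ.ne') y)
    have h2 : ∀ y ∈ Y, (t : ℂ) + ρ * I ≠ (y : ℂ) := fun y _ =>
      sub_ne_zero.1 (sub_ofReal_ne_zero (by simpa using hρ.ne') y)
    simp only [D, regularPart_eq F Y hY h1, regularPart_eq F Y hY h2, ← inv_line_sub_inv_line hρ,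
      mul_sub, Finset.sum_sub_distrib, hc]
    ring
  have hker : ∀ y : ℝ, Integrable fun t : ℝ =>
      c y * (2 * I * ((ρ / ((t - y) ^ 2 + ρ ^ 2) : ℝ) : ℂ)) := fun y =>
    (((integrable_and_integral_div_sub_sq_add_sq hρ y).1.ofReal).const_mul (2 * I)).const_mul (c y)
  have hsum : Integrable fun t : ℝ =>
      ∑ y ∈ Y, c y * (2 * I * ((ρ / ((t - y) ^ 2 + ρ ^ 2) : ℝ) : ℂ)) :=
    integrable_finsetSum Y fun y _ => hker y
  have hsub : Integrable fun t : ℝ => F (t - ρ * I) / (∏ y ∈ Y, ((t : ℂ) - ρ * I - (y : ℂ))) -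
      F (t + ρ * I) / ∏ y ∈ Y, ((t : ℂ) + ρ * I - (y : ℂ)) := hlo.sub hup
  have hint : Integrable fun t : ℝ => D (t - ρ * I) - D (t + ρ * I) := by
    simp only [hdiff]
    exact hsub.sub hsum
  have hT := intervalIntegral_tendsto_integral hint tendsto_neg_atTop_atBot tendsto_id
  have hzero : Tendsto (fun T : ℝ => ∫ t in (-T)..T, (D (t - ρ * I) - D (t + ρ * I)))
      atTop (𝓝 0) := by
    have hrect : ∀ T : ℝ, (∫ t in (-T)..T, (D (t - ρ * I) - D (t + ρ * I))) =
        I • (∫ s in (-ρ)..ρ, D (((-T : ℝ) : ℂ) + s * I)) - I • ∫ s in (-ρ)..ρ, D (T + s * I) := by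
      intro T
      have h := integral_boundary_rect_eq_zero_of_differentiableOn D ⟨-T, -ρ⟩ ⟨T, ρ⟩
        (hD.mono fun z hz => by
          have := hz.2
          rw [Set.uIcc_of_le (by linarith : -ρ ≤ ρ)] at this
          exact this)
      simp only [ofReal_neg, neg_mul, ← sub_eq_add_neg] at h
      rw [intervalIntegral.integral_sub (hclo.intervalIntegrable _ _)
        (hcup.intervalIntegrable _ _)]
      push_cast
      linear_combination h
    rw [Metric.tendsto_atTop]
    intro ε hε
    obtain ⟨T₀, hT₀⟩ := eventually_stripAtInfty.1
      (hDlim.eventually (Metric.ball_mem_nhds 0 (by positivity : 0 < ε / (8 * ρ))))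
    refine ⟨max T₀ 0, fun T hT => ?_⟩
    have hside : ∀ r : ℝ, |r| = T → ‖∫ s in (-ρ)..ρ, D (r + s * I)‖ ≤ ε / 4 := by
      intro r hr
      have h := intervalIntegral.norm_integral_le_of_norm_le_const (a := -ρ) (b := ρ)
        (f := fun s : ℝ => D (r + s * I)) (C := ε / (8 * ρ)) fun s hs => by
          rw [Set.uIoc_of_le (by linarith)] at hs
          have := hT₀ (r + s * I) (add_mul_I_mem_closedStrip (abs_le.2 ⟨hs.1.le, hs.2⟩) r)
            (by simpa [hr] using (le_max_left _ _).trans hT)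
          rw [dist_zero_right] at this
          exact this.le
      refine h.trans (le_of_eq ?_)
      rw [sub_neg_eq_add, abs_of_pos (by linarith)]
      field_simp
      ring
    have hTpos : 0 ≤ T := (le_max_right _ _).trans hT
    rw [dist_zero_right, hrect]
    calc _ ≤ ‖I • ∫ s in (-ρ)..ρ, D (((-T : ℝ) : ℂ) + s * I)‖ + ‖I • ∫ s in (-ρ)..ρ, D (T + s * I)‖ :=
          norm_sub_le _ _
      _ ≤ ε / 4 + ε / 4 := by
          rw [norm_smul, norm_smul, norm_I, one_mul, one_mul]
          exact add_le_add (hside _ (by rw [abs_neg, abs_of_nonneg hTpos]))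
            (hside _ (abs_of_nonneg hTpos))
      _ < ε := by linarith
  have h0 := tendsto_nhds_unique hT hzero
  simp only [hdiff] at h0
  rw [integral_sub hsub hsum, integral_sub hlo hup,
    integral_finsetSum Y fun y _ => hker y] at h0
  have hval : ∀ y : ℝ, ∫ t : ℝ, c y * (2 * I * ((ρ / ((t - y) ^ 2 + ρ ^ 2) : ℝ) : ℂ)) =
      2 * Real.pi * I * c y := fun y => by
    rw [integral_const_mul, integral_const_mul, integral_complex_ofReal,
      (integrable_and_integral_div_sub_sq_add_sq hρ y).2]
    ring
  simp only [hval] at h0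
  rw [← Finset.mul_sum] at h0
  linear_combination h0

end StripResidues

/-! ### The interpolation error as an integral over the boundary of the strip -/

section InterpolationError

open Complex

/-- The sum of the residues at the nodes and at a further point `x` is the interpolation error at
`x`, divided by the nodal polynomial. -/
theorem sum_nodalWeight_insert_mul (F : ℂ → ℂ) (Z : Finset ℝ) {x : ℝ} (hx : x ∉ Z)
    {q : Polynomial ℂ} (hq : q.degree < Z.card) (hqF : ∀ y ∈ Z, q.eval (y : ℂ) = F y) :
    (∑ y ∈ insert x Z, Lagrange.nodalWeight (insert x Z) (fun y : ℝ => (y : ℂ)) y * F y) *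
        ∏ y ∈ Z, ((x : ℂ) - y) = F x - q.eval (x : ℂ) := by
  have hxy : ∀ y ∈ Z, (x : ℂ) ≠ y := fun y hy h => hx (ofReal_injective h ▸ hy)
  have hinj : Set.InjOn (fun y : ℝ => (y : ℂ)) Z := ofReal_injective.injOn
  have hW : ∏ y ∈ Z, ((x : ℂ) - y) ≠ 0 :=
    Finset.prod_ne_zero_iff.2 fun y hy => sub_ne_zero.2 (hxy y hy)
  have hqi := Lagrange.eq_interpolate_of_eval_eq (fun y : ℝ => F y) hinj hq hqF
  have hqx := Lagrange.eval_interpolate_not_at_node (s := Z) (v := fun y : ℝ => (y : ℂ))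
    (fun y : ℝ => F y) hxy
  rw [← hqi, Lagrange.eval_nodal] at hqx
  have h1 : Lagrange.nodalWeight (insert x Z) (fun y : ℝ => (y : ℂ)) x =
      (∏ y ∈ Z, ((x : ℂ) - y))⁻¹ := by
    rw [Lagrange.nodalWeight, Finset.erase_insert hx, Finset.prod_inv_distrib]
  have h2 : ∀ y ∈ Z, Lagrange.nodalWeight (insert x Z) (fun y : ℝ => (y : ℂ)) y * F y =
      -(Lagrange.nodalWeight Z (fun y : ℝ => (y : ℂ)) y * ((x : ℂ) - y)⁻¹ * F y) := by
    intro y hy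
    have hne : x ≠ y := fun h => hx (h ▸ hy)
    rw [Lagrange.nodalWeight, Finset.erase_insert_of_ne hne,
      Finset.prod_insert fun h => hx (Finset.mem_of_mem_erase h), Lagrange.nodalWeight,
      ← neg_sub, inv_neg]
    ring
  rw [Finset.sum_insert hx, h1, Finset.sum_congr rfl h2, Finset.sum_neg_distrib, hqx]
  field_simp
  ring

theorem le_norm_sub_ofReal {ρ : ℝ} {z : ℂ} (hz : ρ ≤ |z.im|) (y : ℝ) : ρ ≤ ‖z - y‖ := by
  have := abs_im_le_norm (z - y)
  rw [sub_im, ofReal_im, sub_zero] at this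
  exact hz.trans this

theorem tendsto_div_prod_sub_stripAtInfty {F : ℂ → ℂ} {ρ M : ℝ} {m : ℕ} (Z : Finset ℝ) {x : ℝ}
    (hx : x ∉ Z) (hFM : ∀ z ∈ closedStrip ρ, ‖F z‖ ≤ M * (1 + z.re ^ 2) ^ m)
    (hm : 2 * m ≤ Z.card) :
    Tendsto (fun z => F z / ∏ y ∈ insert x Z, (z - (y : ℂ))) (stripAtInfty ρ) (𝓝 0) := by
  have hstrip : ∀ᶠ z in stripAtInfty ρ, z ∈ closedStrip ρ :=
    mem_inf_of_right (mem_principal_self _)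
  have hM : 0 ≤ M ∨ closedStrip ρ = ∅ := by
    rcases Set.eq_empty_or_nonempty (closedStrip ρ) with h | ⟨z, hz⟩
    · exact Or.inr h
    · left
      have h1 := (norm_nonneg _).trans (hFM z hz)
      exact nonneg_of_mul_nonneg_left h1 (by positivity)
  have hb : ∀ᶠ z in stripAtInfty ρ, ‖F z / ∏ y ∈ insert x Z, (z - (y : ℂ))‖ ≤
      M * 2 ^ m * 2 ^ Z.card * ‖(z - (x : ℂ))⁻¹‖ := by
    have hfar : ∀ᶠ z in stripAtInfty ρ, ∀ y ∈ Z, 2 * |y| ≤ |z.re| := by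
      rw [Finset.eventually_all]
      exact fun y _ => (tendsto_abs_re_stripAtInfty ρ).eventually_ge_atTop _
    filter_upwards [hstrip, hfar, (tendsto_abs_re_stripAtInfty ρ).eventually_ge_atTop 1]
      with z hz hzf hz1
    have hM : 0 ≤ M := hM.resolve_right (Set.nonempty_iff_ne_empty.1 ⟨z, hz⟩)
    have hlow : (|z.re| / 2) ^ Z.card ≤ ‖∏ y ∈ Z, (z - (y : ℂ))‖ := by
      rw [norm_prod, ← Finset.prod_const]
      refine Finset.prod_le_prod (fun _ _ => by positivity) fun y hy => ?_
      linarith [abs_re_sub_le_norm z y, hzf y hy]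
    have hpos : 0 < ‖∏ y ∈ Z, (z - (y : ℂ))‖ := lt_of_lt_of_le (by positivity) hlow
    have hF : ‖F z‖ ≤ M * 2 ^ m * 2 ^ Z.card * ‖∏ y ∈ Z, (z - (y : ℂ))‖ := by
      calc ‖F z‖ ≤ M * (1 + z.re ^ 2) ^ m := hFM z hz
        _ ≤ M * (2 * |z.re| ^ 2) ^ m := by
            gcongr
            have := pow_le_pow_left₀ zero_le_one hz1 2
            rw [sq_abs] at this ⊢
            linarith
        _ = M * 2 ^ m * |z.re| ^ (2 * m) := by rw [mul_pow, ← pow_mul, mul_assoc]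
        _ ≤ M * 2 ^ m * |z.re| ^ Z.card := by gcongr
        _ = M * 2 ^ m * 2 ^ Z.card * (|z.re| / 2) ^ Z.card := by
            rw [div_pow]; field_simp
        _ ≤ _ := by gcongr
    rw [Finset.prod_insert hx, norm_div, norm_mul, norm_inv, mul_comm ‖z - (x : ℂ)‖, ← div_div,
      div_eq_mul_inv _ ‖z - (x : ℂ)‖]
    gcongr
    rwa [div_le_iff₀ hpos]
  refine squeeze_zero_norm' hb ?_
  simpa using (tendsto_inv_sub_stripAtInfty ρ x).norm.const_mul (M * 2 ^ m * 2 ^ Z.card)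

/-- Integral over one boundary line, parametrized by `z`, of `F / ((z - x) W)`, where `|z - x| ≥ ρ`. -/
theorem integrable_and_norm_integral_div_le {F W : ℝ → ℂ} {x a ρ : ℝ} {z : ℝ → ℂ} (hρ : 0 < ρ)
    (hF : Continuous F) (hW : Continuous W) (hz : Continuous z) (hW0 : ∀ t, W t ≠ 0)
    (hzρ : ∀ t, ρ ≤ ‖z t - x‖) (hFW : ∀ t, ‖F t‖ ≤ a * (1 + t ^ 2)⁻¹ * ‖W t‖) :
    Integrable (fun t => F t / ((z t - x) * W t)) ∧
      ‖∫ t, F t / ((z t - x) * W t)‖ ≤ a / ρ * Real.pi := by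
  have hz0 : ∀ t, z t - x ≠ 0 := fun t => norm_pos_iff.1 (hρ.trans_le (hzρ t))
  have hb : ∀ t, ‖F t / ((z t - x) * W t)‖ ≤ a / ρ * (1 + t ^ 2)⁻¹ := by
    intro t
    have hWp : 0 < ‖W t‖ := norm_pos_iff.2 (hW0 t)
    have ha : 0 ≤ a * (1 + t ^ 2)⁻¹ :=
      nonneg_of_mul_nonneg_left ((norm_nonneg _).trans (hFW t)) hWp
    rw [norm_div, norm_mul, div_le_iff₀ (mul_pos (hρ.trans_le (hzρ t)) hWp)]
    calc ‖F t‖ ≤ a * (1 + t ^ 2)⁻¹ * ‖W t‖ := hFW t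
      _ = a * (1 + t ^ 2)⁻¹ / ρ * (ρ * ‖W t‖) := by field_simp
      _ ≤ a * (1 + t ^ 2)⁻¹ / ρ * (‖z t - x‖ * ‖W t‖) := by gcongr; exact hzρ t
      _ = _ := by ring
  have hint : Integrable fun t : ℝ => a / ρ * (1 + t ^ 2)⁻¹ :=
    integrable_inv_one_add_sq.const_mul _
  refine ⟨hint.mono' ?_ (Eventually.of_forall hb), ?_⟩
  · refine Continuous.aestronglyMeasurable (hF.div ((hz.sub continuous_const).mul hW) fun t => ?_)
    exact mul_ne_zero (hz0 t) (hW0 t)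
  · refine (norm_integral_le_of_norm_le hint (Eventually.of_forall hb)).trans (le_of_eq ?_)
    rw [integral_const_mul, integral_univ_inv_one_add_sq]

/-- The interpolation error, bounded by comparing `F` with the nodal polynomial on the two lines
bounding the strip. -/
theorem norm_sub_eval_le_of_strip {F : ℂ → ℂ} {ρ M a : ℝ} {m : ℕ} (hρ : 0 < ρ)
    (hF : AnalyticOnNhd ℂ F (closedStrip ρ)) (Z : Finset ℝ)
    (hFM : ∀ z ∈ closedStrip ρ, ‖F z‖ ≤ M * (1 + z.re ^ 2) ^ m) (hm : 2 * m ≤ Z.card)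
    (hlo : ∀ t : ℝ, ‖F (t - ρ * I)‖ ≤
      a * (1 + t ^ 2)⁻¹ * ‖∏ y ∈ Z, ((t : ℂ) - ρ * I - (y : ℂ))‖)
    (hup : ∀ t : ℝ, ‖F (t + ρ * I)‖ ≤
      a * (1 + t ^ 2)⁻¹ * ‖∏ y ∈ Z, ((t : ℂ) + ρ * I - (y : ℂ))‖)
    {q : Polynomial ℂ} (hq : q.degree < Z.card) (hqF : ∀ y ∈ Z, q.eval (y : ℂ) = F y)
    {x : ℝ} (hx : x ∉ Z) :
    ‖F x - q.eval (x : ℂ)‖ ≤ ‖∏ y ∈ Z, ((x : ℂ) - y)‖ * (a / ρ) := by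
  have hmem : ∀ s : ℝ, |s| ≤ ρ → Continuous fun t : ℝ => F (t + s * I) := fun s hs =>
    hF.continuousOn.comp_continuous (by fun_prop) fun t => add_mul_I_mem_closedStrip hs t
  have hρabs : |ρ| ≤ ρ := (abs_of_pos hρ).le
  have hcup : Continuous fun t : ℝ => F (t + ρ * I) := hmem ρ hρabs
  have hclo : Continuous fun t : ℝ => F (t - ρ * I) := by
    simpa [sub_eq_add_neg] using hmem (-ρ) (by rwa [abs_neg])
  have hL := integrable_and_norm_integral_div_le (x := x) (z := fun t : ℝ => (t : ℂ) - ρ * I) hρ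
    hclo (W := fun t : ℝ => ∏ y ∈ Z, ((t : ℂ) - ρ * I - (y : ℂ))) (by fun_prop) (by fun_prop)
    (fun t => Finset.prod_ne_zero_iff.2 fun y _ => sub_ofReal_ne_zero (by simpa using hρ.ne') y)
    (fun t => le_norm_sub_ofReal (by simp [abs_of_pos hρ]) x) hlo
  have hU := integrable_and_norm_integral_div_le (x := x) (z := fun t : ℝ => (t : ℂ) + ρ * I) hρ
    hcup (W := fun t : ℝ => ∏ y ∈ Z, ((t : ℂ) + ρ * I - (y : ℂ))) (by fun_prop) (by fun_prop)
    (fun t => Finset.prod_ne_zero_iff.2 fun y _ => sub_ofReal_ne_zero (by simpa using hρ.ne') y)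
    (fun t => le_norm_sub_ofReal (by simp [abs_of_pos hρ]) x) hup
  have hins : ∀ z : ℂ, (z - x) * ∏ y ∈ Z, (z - (y : ℂ)) = ∏ y ∈ insert x Z, (z - (y : ℂ)) :=
    fun z => (Finset.prod_insert (f := fun y : ℝ => z - (y : ℂ)) hx).symm
  simp only [hins] at hL hU
  have hres := integral_line_sub_integral_line hρ hF (insert x Z) (Finset.insert_nonempty x Z)
    (tendsto_div_prod_sub_stripAtInfty Z hx hFM hm) hL.1 hU.1
  rw [← sum_nodalWeight_insert_mul F Z hx hq hqF, norm_mul, mul_comm]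
  refine mul_le_mul_of_nonneg_left ?_ (norm_nonneg _)
  have hn := congrArg norm hres
  rw [norm_mul, norm_mul, norm_mul, norm_I, mul_one, Complex.norm_two, norm_real,
    Real.norm_eq_abs, abs_of_pos Real.pi_pos] at hn
  have hle := (norm_sub_le _ _).trans (add_le_add hL.2 hU.2)
  rw [hn] at hle
  refine le_of_mul_le_mul_left ?_ (by positivity : 0 < 2 * Real.pi)
  linarith

end InterpolationError

/-! ### Interpolation in the span of the Hermite functions -/

section Interpolants

open Polynomial

/-- A polynomial multiplied by the Gaussian `exp (-x² / 2)`, as a function on the real line. -/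
noncomputable def gaussMul : ℂ[X] →ₗ[ℂ] (ℝ → ℂ) where
  toFun q x := (Real.exp (-x ^ 2 / 2) : ℂ) * q.eval (x : ℂ)
  map_add' p q := by funext x; simp [mul_add]
  map_smul' c q := by funext x; simp [mul_left_comm]

theorem gaussMul_apply (q : ℂ[X]) (x : ℝ) :
    gaussMul q x = (Real.exp (-x ^ 2 / 2) : ℂ) * q.eval (x : ℂ) := rfl

theorem hermiteGamma_pos (n : ℕ) : 0 < hermiteGamma n := by
  rw [hermiteGamma]; positivity

theorem gaussMul_map_hermitePoly (n : ℕ) :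
    gaussMul ((hermitePoly n).map (algebraMap ℝ ℂ)) =
      (√(hermiteGamma n) : ℂ) • fun x : ℝ => ((hermitePsi n x : ℝ) : ℂ) := by
  funext x
  have h : ((hermitePoly n).map (algebraMap ℝ ℂ)).eval (x : ℂ) = ((hermiteH n x : ℝ) : ℂ) := by
    rw [← hermiteC_ofReal, hermiteC, aeval_def, eval_map]
  have hγ : (√(hermiteGamma n) : ℂ) ≠ 0 :=
    Complex.ofReal_ne_zero.2 (Real.sqrt_pos.2 (hermiteGamma_pos n)).ne'
  rw [gaussMul_apply, h, Pi.smul_apply, smul_eq_mul, hermitePsi]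
  push_cast
  field_simp

theorem gaussMul_mem_hermiteSpan {n m : ℕ} (hm : m ≤ n + 1) {q : ℂ[X]} (hq : q.degree < m) :
    gaussMul q ∈ hermiteSpan n := by
  induction m generalizing q with
  | zero =>
    have : q = 0 := by simpa using hq
    rw [this, map_zero]
    exact zero_mem _
  | succ m ih =>
    -- Subtract the multiple of `H_m` with the same coefficient of `X ^ m`.
    set p := (hermitePoly m).map (algebraMap ℝ ℂ)
    set c : ℂ := q.coeff m / 2 ^ m
    have hpm : p.coeff m = 2 ^ m := by
      have := leadingCoeff_hermitePoly m
      rw [leadingCoeff, natDegree_hermitePoly] at this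
      rw [coeff_map, this]; simp
    have hlow : (q - c • p).degree < m := by
      rw [degree_lt_iff_coeff_zero]
      intro k hk
      rw [coeff_sub, coeff_smul, smul_eq_mul]
      rcases hk.eq_or_lt with rfl | hk
      · rw [hpm]; simp [c]
      · rw [(degree_lt_iff_coeff_zero q (m + 1)).1 hq k hk, coeff_map,
          coeff_eq_zero_of_natDegree_lt (by rw [natDegree_hermitePoly]; exact hk)]
        simp
    have hp : gaussMul p ∈ hermiteSpan n := by
      rw [gaussMul_map_hermitePoly]
      exact Submodule.smul_mem _ _ (Submodule.subset_span ⟨m, by omega, rfl⟩)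
    have := Submodule.add_mem _ (ih (by omega) hlow) (Submodule.smul_mem _ c hp)
    rwa [← map_smul, ← map_add, sub_add_cancel] at this

theorem mem_hermiteSpan_iff {n : ℕ} {g : ℝ → ℂ} :
    g ∈ hermiteSpan n ↔ ∃ q : ℂ[X], q.degree < (n + 1 : ℕ) ∧ gaussMul q = g := by
  constructor
  · intro hg
    suffices hermiteSpan n ≤ (degreeLT ℂ (n + 1)).map gaussMul by
      obtain ⟨q, hq, hqg⟩ := this hg
      exact ⟨q, mem_degreeLT.1 hq, hqg⟩
    refine Submodule.span_le.2 ?_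
    rintro _ ⟨k, hk, rfl⟩
    have hγ : (√(hermiteGamma k) : ℂ) ≠ 0 :=
      Complex.ofReal_ne_zero.2 (Real.sqrt_pos.2 (hermiteGamma_pos k)).ne'
    refine ⟨(√(hermiteGamma k) : ℂ)⁻¹ • (hermitePoly k).map (algebraMap ℝ ℂ), ?_, ?_⟩
    · refine Submodule.smul_mem _ _ (mem_degreeLT.2 ?_)
      refine lt_of_le_of_lt degree_le_natDegree ?_
      rw [natDegree_map, natDegree_hermitePoly]
      exact_mod_cast Nat.lt_succ_of_le hk
    · rw [map_smul, gaussMul_map_hermitePoly, smul_smul, inv_mul_cancel₀ hγ, one_smul]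
  · rintro ⟨q, hq, rfl⟩
    exact gaussMul_mem_hermiteSpan le_rfl hq

/-- The function `F(z) = exp (z² / 2) f(z)`. Interpolating `f` in `ℍ_n` amounts to interpolating `F`
by polynomials of degree at most `n`. -/
noncomputable def gaussQuot (f : ℂ → ℂ) (z : ℂ) : ℂ := Complex.exp (z ^ 2 / 2) * f z

theorem exp_mul_gaussQuot (f : ℂ → ℂ) (x : ℝ) :
    (Real.exp (-x ^ 2 / 2) : ℂ) * gaussQuot f x = f x := by
  rw [gaussQuot, Complex.ofReal_exp, ← mul_assoc, ← Complex.exp_add]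
  push_cast
  rw [show -(x : ℂ) ^ 2 / 2 + (x : ℂ) ^ 2 / 2 = 0 by ring, Complex.exp_zero, one_mul]

theorem isHermiteInterpolant_iff {f : ℂ → ℂ} {n : ℕ} {g : ℝ → ℂ} :
    IsHermiteInterpolant f n g ↔ ∃ q : ℂ[X], q.degree < (hermiteZeros (n + 1)).card ∧
      (∀ y ∈ hermiteZeros (n + 1), q.eval (y : ℂ) = gaussQuot f y) ∧ gaussMul q = g := by
  have hval : ∀ (q : ℂ[X]) (y : ℝ), gaussMul q y = f y ↔ q.eval (y : ℂ) = gaussQuot f y := by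
    intro q y
    rw [gaussMul_apply, ← exp_mul_gaussQuot f y]
    exact mul_right_inj' (Complex.ofReal_ne_zero.2 (Real.exp_pos _).ne')
  rw [IsHermiteInterpolant, mem_hermiteSpan_iff, card_hermiteZeros]
  constructor
  · rintro ⟨⟨q, hq, rfl⟩, h⟩
    exact ⟨q, hq, fun y hy => (hval q y).1 (h y (mem_hermiteZeros.1 hy)), rfl⟩
  · rintro ⟨q, hq, h, rfl⟩
    exact ⟨⟨q, hq, rfl⟩, fun y hy => (hval q y).2 (h y (mem_hermiteZeros.2 hy))⟩

theorem existsUnique_isHermiteInterpolant (f : ℂ → ℂ) (n : ℕ) :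
    ∃! h : ℝ → ℂ, IsHermiteInterpolant f n h := by
  have hinj : Set.InjOn (fun y : ℝ => (y : ℂ)) (hermiteZeros (n + 1)) :=
    Complex.ofReal_injective.injOn
  set q := Lagrange.interpolate (hermiteZeros (n + 1)) (fun y : ℝ => (y : ℂ))
    fun y : ℝ => gaussQuot f y
  refine ⟨gaussMul q, isHermiteInterpolant_iff.2 ⟨q, Lagrange.degree_interpolate_lt _ hinj,
    fun y hy => Lagrange.eval_interpolate_at_node _ hinj hy, rfl⟩, ?_⟩
  intro g hg
  obtain ⟨p, hp, hpf, rfl⟩ := isHermiteInterpolant_iff.1 hg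
  rw [Lagrange.eq_interpolate_of_eval_eq (fun y : ℝ => gaussQuot f y) hinj hp hpf]

theorem exists_norm_gaussMul_le (q : ℂ[X]) : ∃ b : ℝ, ∀ x : ℝ, ‖gaussMul q x‖ ≤ b := by
  refine ⟨∑ i ∈ q.support, ‖q.coeff i‖ * (i.factorial * Real.exp (1 / 2)), fun x => ?_⟩
  rw [gaussMul_apply, eval_eq_sum, Polynomial.sum, Finset.mul_sum]
  refine norm_sum_le_of_le _ fun i _ => ?_
  rw [norm_mul, norm_mul, norm_pow, Complex.norm_real, Complex.norm_real, Real.norm_eq_abs,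
    Real.abs_exp, Real.norm_eq_abs, mul_left_comm]
  refine mul_le_mul_of_nonneg_left ?_ (norm_nonneg _)
  have h1 := Real.pow_div_factorial_le_exp |x| (abs_nonneg x) i
  rw [div_le_iff₀ (by positivity)] at h1
  have h2 : Real.exp (-x ^ 2 / 2) * Real.exp |x| ≤ Real.exp (1 / 2) := by
    rw [← Real.exp_add, Real.exp_le_exp]
    nlinarith [sq_nonneg (|x| - 1), sq_abs x]
  calc Real.exp (-x ^ 2 / 2) * |x| ^ i ≤ Real.exp (-x ^ 2 / 2) * (Real.exp |x| * i.factorial) :=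
        mul_le_mul_of_nonneg_left h1 (Real.exp_pos _).le
    _ = i.factorial * (Real.exp (-x ^ 2 / 2) * Real.exp |x|) := by ring
    _ ≤ _ := mul_le_mul_of_nonneg_left h2 (by positivity)

end Interpolants

/-! ### The error bound -/

section ErrorBound

/-- Polynomial growth of `F = exp (z² / 2) f` in the whole strip, near the origin by compactness; the
real exponent is replaced by a natural one. -/
theorem exists_norm_gaussQuot_le {f : ℂ → ℂ} {ρ σ C R : ℝ}
    (hf : AnalyticOnNhd ℂ f (closedStrip ρ))
    (hgrowth : ∀ z ∈ closedStrip ρ, R ≤ ‖z‖ →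
      ‖Complex.exp (z ^ 2 / 2) * f z‖ ≤ C * ‖z‖ ^ σ) :
    ∃ (M : ℝ) (m : ℕ), 0 < M ∧
      ∀ z ∈ closedStrip ρ, ‖gaussQuot f z‖ ≤ M * (1 + z.re ^ 2) ^ m := by
  obtain ⟨m, hm⟩ := exists_nat_ge σ
  have hclosed : IsClosed (closedStrip ρ) :=
    isClosed_Icc.preimage Complex.continuous_im
  have hK : IsCompact (Metric.closedBall (0 : ℂ) (max R 1) ∩ closedStrip ρ) :=
    (isCompact_closedBall 0 (max R 1)).inter_right hclosed
  have hcont : ContinuousOn (gaussQuot f) (Metric.closedBall (0 : ℂ) (max R 1) ∩ closedStrip ρ) :=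
    (Continuous.continuousOn (by fun_prop)).mul (hf.continuousOn.mono Set.inter_subset_right)
  obtain ⟨M₁, hM₁⟩ := hK.exists_bound_of_continuousOn hcont
  refine ⟨|M₁| + |C| * (1 + ρ ^ 2) ^ m + 1, m, by positivity, fun z hz => ?_⟩
  have h1 : 1 ≤ (1 + z.re ^ 2) ^ m := one_le_pow₀ (by nlinarith [sq_nonneg z.re])
  rcases le_total ‖z‖ (max R 1) with h | h
  · calc ‖gaussQuot f z‖ ≤ |M₁| := (hM₁ z ⟨by simpa using h, hz⟩).trans (le_abs_self _)
      _ ≤ |M₁| + |C| * (1 + ρ ^ 2) ^ m + 1 := by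
          have : 0 ≤ |C| * (1 + ρ ^ 2) ^ m := by positivity
          linarith
      _ ≤ _ := le_mul_of_one_le_right (by positivity) h1
  · have hz1 : 1 ≤ ‖z‖ := (le_max_right _ _).trans h
    have hsq : ‖z‖ ^ 2 ≤ (1 + ρ ^ 2) * (1 + z.re ^ 2) := by
      have him : z.im ^ 2 ≤ ρ ^ 2 := sq_le_sq' hz.1 hz.2
      rw [← Complex.normSq_eq_norm_sq, Complex.normSq_apply]
      nlinarith [mul_nonneg (sq_nonneg ρ) (sq_nonneg z.re)]
    calc ‖gaussQuot f z‖ ≤ C * ‖z‖ ^ σ := hgrowth z hz ((le_max_left _ _).trans h)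
      _ ≤ |C| * ‖z‖ ^ σ := mul_le_mul_of_nonneg_right (le_abs_self C) (by positivity)
      _ ≤ |C| * ((1 + ρ ^ 2) * (1 + z.re ^ 2)) ^ m := by
          refine mul_le_mul_of_nonneg_left ?_ (abs_nonneg C)
          calc ‖z‖ ^ σ ≤ ‖z‖ ^ (m : ℝ) := Real.rpow_le_rpow_of_exponent_le hz1 hm
            _ = ‖z‖ ^ m := Real.rpow_natCast _ _
            _ ≤ (‖z‖ ^ 2) ^ m := by
                refine pow_le_pow_left₀ (norm_nonneg _) ?_ m
                nlinarith
            _ ≤ _ := pow_le_pow_left₀ (by positivity) hsq m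
      _ = |C| * (1 + ρ ^ 2) ^ m * (1 + z.re ^ 2) ^ m := by rw [mul_pow, mul_assoc]
      _ ≤ _ := by
          refine mul_le_mul_of_nonneg_right ?_ (by positivity)
          linarith [abs_nonneg M₁]

/-- A function whose product with `exp (z² / 2)` grows polynomially decays in the strip. -/
theorem exists_norm_le_inv_one_add_sq {f : ℂ → ℂ} {ρ M : ℝ} {m : ℕ}
    (hM : ∀ z ∈ closedStrip ρ, ‖gaussQuot f z‖ ≤ M * (1 + z.re ^ 2) ^ m) (hM0 : 0 < M) :
    ∃ B : ℝ, 0 < B ∧ ∀ z ∈ closedStrip ρ, ‖f z‖ ≤ B * (1 + z.re ^ 2)⁻¹ := by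
  refine ⟨Real.exp (ρ ^ 2 / 2) * Real.exp (1 / 2) * M * (2 ^ (m + 1) * (m + 1).factorial),
    by positivity, fun z hz => ?_⟩
  have hfz : f z = Complex.exp (-(z ^ 2 / 2)) * gaussQuot f z := by
    rw [gaussQuot, ← mul_assoc, ← Complex.exp_add, neg_add_cancel, Complex.exp_zero, one_mul]
  have hexp : ‖Complex.exp (-(z ^ 2 / 2))‖ ≤ Real.exp (ρ ^ 2 / 2) * Real.exp (-z.re ^ 2 / 2) := by
    have him : z.im ^ 2 ≤ ρ ^ 2 := sq_le_sq' hz.1 hz.2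
    have hre : (-(z ^ 2 / 2)).re = -((z.re ^ 2 - z.im ^ 2) / 2) := by
      rw [Complex.neg_re, show z ^ 2 / 2 = z ^ 2 / ((2 : ℝ) : ℂ) by norm_num, Complex.div_ofReal_re,
        sq, Complex.mul_re]
      ring
    rw [Complex.norm_exp, hre, ← Real.exp_add, Real.exp_le_exp]
    linarith
  have hpow : (1 + z.re ^ 2) ^ (m + 1) * Real.exp (-z.re ^ 2 / 2) ≤
      Real.exp (1 / 2) * (2 ^ (m + 1) * (m + 1).factorial) := by
    have h := Real.pow_div_factorial_le_exp ((1 + z.re ^ 2) / 2) (by positivity) (m + 1)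
    rw [div_le_iff₀ (by positivity), div_pow, div_le_iff₀ (by positivity)] at h
    have he : Real.exp ((1 + z.re ^ 2) / 2) * Real.exp (-z.re ^ 2 / 2) = Real.exp (1 / 2) := by
      rw [← Real.exp_add]; ring_nf
    calc _ ≤ Real.exp ((1 + z.re ^ 2) / 2) * (m + 1).factorial * 2 ^ (m + 1) *
          Real.exp (-z.re ^ 2 / 2) := mul_le_mul_of_nonneg_right h (Real.exp_pos _).le
      _ = Real.exp ((1 + z.re ^ 2) / 2) * Real.exp (-z.re ^ 2 / 2) *
          (2 ^ (m + 1) * (m + 1).factorial) := by ring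
      _ = _ := by rw [he]
  rw [hfz, norm_mul, ← div_eq_mul_inv, le_div_iff₀ (by positivity)]
  calc _ ≤ Real.exp (ρ ^ 2 / 2) * Real.exp (-z.re ^ 2 / 2) * (M * (1 + z.re ^ 2) ^ m) *
        (1 + z.re ^ 2) := by gcongr; exact hM z hz
    _ = Real.exp (ρ ^ 2 / 2) * M * ((1 + z.re ^ 2) ^ (m + 1) * Real.exp (-z.re ^ 2 / 2)) := by ring
    _ ≤ Real.exp (ρ ^ 2 / 2) * M * (Real.exp (1 / 2) * (2 ^ (m + 1) * (m + 1).factorial)) := by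
        gcongr
    _ = _ := by ring

theorem integrable_stripBoundaryAbs {f : ℂ → ℂ} {ρ B : ℝ} (hρ : 0 < ρ)
    (hf : AnalyticOnNhd ℂ f (closedStrip ρ))
    (hB : ∀ z ∈ closedStrip ρ, ‖f z‖ ≤ B * (1 + z.re ^ 2)⁻¹) :
    Integrable (stripBoundaryAbs f ρ) := by
  have hline : ∀ s : ℝ, |s| ≤ ρ → Integrable fun t : ℝ => ‖f (t + s * Complex.I)‖ := by
    intro s hs
    have hcont : Continuous fun t : ℝ => f (t + s * Complex.I) :=
      hf.continuousOn.comp_continuous (by fun_prop) fun t => add_mul_I_mem_closedStrip hs t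
    refine (integrable_inv_one_add_sq.const_mul B).mono' hcont.norm.aestronglyMeasurable
      (Eventually.of_forall fun t => ?_)
    rw [norm_norm]
    simpa using hB _ (add_mul_I_mem_closedStrip hs t)
  have hlo := hline (-ρ) (by rw [abs_neg, abs_of_pos hρ])
  simp only [Complex.ofReal_neg, neg_mul, ← sub_eq_add_neg] at hlo
  exact (hline ρ (abs_of_pos hρ).le).add hlo

/-- The error of the interpolant at the zeros of `H_{n+1}`, for all sufficiently large `n`. -/
theorem exists_norm_sub_interpolant_mul_sinh_le {f : ℂ → ℂ} {ρ M : ℝ} {m : ℕ} (hρ : 0 < ρ)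
    (hf : AnalyticOnNhd ℂ f (closedStrip ρ)) (hM0 : 0 < M)
    (hM : ∀ z ∈ closedStrip ρ, ‖gaussQuot f z‖ ≤ M * (1 + z.re ^ 2) ^ m) :
    ∃ A : ℝ, 0 < A ∧ ∀ n : ℕ, 3 * ρ ^ 2 + 1 ≤ n → 4 * (m + 1) ≤ n →
      ∀ h : ℝ → ℂ, IsHermiteInterpolant f n h → ∀ x : ℝ,
        ‖f x - h x‖ * Real.sinh (√(2 * n + 3) * ρ) ≤ A * (2 * n + 3 : ℝ) ^ (1 / 6 : ℝ) := by
  obtain ⟨c, hc, hline⟩ := exists_mul_norm_hermiteC_le hρ (m + 1)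
  refine ⟨11 * Real.exp (ρ ^ 2 / 2) * (M / (c * ρ)), by positivity, fun n hn hmn h hh x => ?_⟩
  obtain ⟨q, hq, hqF, rfl⟩ := isHermiteInterpolant_iff.1 hh
  have hgF : AnalyticOnNhd ℂ (gaussQuot f) (closedStrip ρ) := fun z hz =>
    (by fun_prop : AnalyticAt ℂ (fun z : ℂ => Complex.exp (z ^ 2 / 2)) z).mul (hf z hz)
  set F := gaussQuot f
  set N := n + 1 with hN
  have hn' : 3 * ρ ^ 2 + 1 ≤ (N : ℝ) := by rw [hN]; push_cast; linarith
  have hlineN := hline N hn' (by omega)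
  have hdiff : f x - gaussMul q x = (Real.exp (-x ^ 2 / 2) : ℂ) * (F x - q.eval (x : ℂ)) := by
    rw [gaussMul_apply, mul_sub, exp_mul_gaussQuot]
  by_cases hx : x ∈ hermiteZeros N
  · rw [hdiff, hqF x hx, sub_self, mul_zero, norm_zero, zero_mul]
    positivity
  set P := ‖hermiteC N (ρ * Complex.I)‖
  have hP : 0 < P := norm_pos_iff.2 (hermiteC_ne_zero N (by simpa using hρ.ne'))
  have hprod : ∀ z : ℂ, ‖∏ y ∈ hermiteZeros N, (z - (y : ℂ))‖ = ‖hermiteC N z‖ / 2 ^ N := fun z => by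
    rw [hermiteC_eq_prod, norm_mul, norm_pow, Complex.norm_two, mul_div_cancel_left₀ _ (by positivity)]
  have hratio : ∀ t : ℝ, M * (1 + t ^ 2) ^ m =
      M * 2 ^ N / (c * P) * (1 + t ^ 2)⁻¹ * (c * (1 + t ^ 2) ^ (m + 1) * P / 2 ^ N) := fun t => by
    field_simp
    ring
  have hupN : ∀ t : ℝ, ‖F (t + ρ * Complex.I)‖ ≤ M * 2 ^ N / (c * P) * (1 + t ^ 2)⁻¹ *
      ‖∏ y ∈ hermiteZeros N, ((t : ℂ) + ρ * Complex.I - (y : ℂ))‖ := fun t => by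
    have h1 := hM _ (add_mul_I_mem_closedStrip (abs_of_pos hρ).le t)
    simp only [Complex.add_re, Complex.ofReal_re, Complex.mul_re, Complex.I_re, mul_zero,
      Complex.ofReal_im, Complex.I_im, mul_one, sub_self, add_zero] at h1
    rw [hprod]
    calc _ ≤ M * (1 + t ^ 2) ^ m := h1
      _ = _ := hratio t
      _ ≤ _ := by gcongr; exact hlineN t
  have hloN : ∀ t : ℝ, ‖F (t - ρ * Complex.I)‖ ≤ M * 2 ^ N / (c * P) * (1 + t ^ 2)⁻¹ *
      ‖∏ y ∈ hermiteZeros N, ((t : ℂ) - ρ * Complex.I - (y : ℂ))‖ := fun t => by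
    have h1 := hM _ (add_mul_I_mem_closedStrip (by rw [abs_neg, abs_of_pos hρ] : |-ρ| ≤ ρ) t)
    simp only [Complex.ofReal_neg, neg_mul, ← sub_eq_add_neg, Complex.sub_re, Complex.ofReal_re,
      Complex.mul_re, Complex.I_re, mul_zero,
      Complex.ofReal_im, Complex.I_im, mul_one, sub_self, sub_zero] at h1
    have hconj : (t : ℂ) - ρ * Complex.I = starRingEnd ℂ (t + ρ * Complex.I) := by
      simp [sub_eq_add_neg]
    rw [hprod]
    calc _ ≤ M * (1 + t ^ 2) ^ m := h1
      _ = _ := hratio t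
      _ ≤ _ := by rw [hconj, norm_hermiteC_conj]; gcongr; exact hlineN t
  have hcard : 2 * m ≤ (hermiteZeros N).card := by rw [card_hermiteZeros]; omega
  have herr := norm_sub_eval_le_of_strip hρ hgF (hermiteZeros N) hM hcard hloN hupN hq hqF hx
  rw [hprod, hermiteC_ofReal, Complex.norm_real, Real.norm_eq_abs, hermiteH_eq_eval] at herr
  -- `2 N + 1 = 2 n + 3` is the eigenvalue of the oscillator, `μ` its cube root.
  set μ : ℝ := (2 * n + 3 : ℝ) ^ (1 / 3 : ℝ) with hμdef
  have hμ3 : μ ^ 3 = 2 * (N : ℝ) + 1 := by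
    rw [hμdef, ← Real.rpow_natCast, ← Real.rpow_mul (by positivity), hN]
    push_cast
    norm_num
    ring
  have hμ2 : 2 ≤ μ := by
    have hn4 : (4 : ℝ) ≤ n := by exact_mod_cast le_trans (by omega) hmn
    refine le_of_pow_le_pow_left₀ (n := 3) (by norm_num) (by positivity) ?_
    rw [hμ3, hN]; push_cast; linarith
  have hsμ : √μ = (2 * n + 3 : ℝ) ^ (1 / 6 : ℝ) := by
    rw [hμdef, Real.sqrt_eq_rpow, ← Real.rpow_mul (by positivity)]
    norm_num
  have hu := exp_mul_hermitePoly_mul_sinh_le hμ2 hμ3 hρ.le x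
  have h23 : 2 * (N : ℝ) + 1 = 2 * n + 3 := by rw [hN]; push_cast; ring
  rw [h23, hsμ] at hu
  have hsinh : 0 ≤ Real.sinh (√(2 * n + 3) * ρ) := Real.sinh_nonneg_iff.2 (by positivity)
  rw [hdiff, norm_mul, Complex.norm_real, Real.norm_eq_abs, Real.abs_exp]
  calc _ ≤ Real.exp (-x ^ 2 / 2) * (|(hermitePoly N).eval x| / 2 ^ N *
        (M * 2 ^ N / (c * P) / ρ)) * Real.sinh (√(2 * n + 3) * ρ) := by gcongr
    _ = Real.exp (-x ^ 2 / 2) * |(hermitePoly N).eval x| * Real.sinh (√(2 * n + 3) * ρ) *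
        (M / (c * P * ρ)) := by field_simp
    _ ≤ 11 * Real.exp (ρ ^ 2 / 2) * (2 * n + 3 : ℝ) ^ (1 / 6 : ℝ) * P * (M / (c * P * ρ)) := by
        gcongr
    _ = _ := by field_simp

theorem exp_le_four_mul_sinh {s : ℝ} (hs : 1 ≤ s) : Real.exp s ≤ 4 * Real.sinh s := by
  rw [Real.sinh_eq]
  have h1 : Real.exp (-s) ≤ 1 := Real.exp_le_one_iff.2 (by linarith)
  have h2 := Real.add_one_le_exp s
  linarith

theorem eLpNorm_top_le_ofReal {g : ℝ → ℂ} {b : ℝ} (hg : ∀ x, ‖g x‖ ≤ b) :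
    eLpNorm g ⊤ volume ≤ ENNReal.ofReal b := by
  rw [eLpNorm_exponent_top]
  exact eLpNormEssSup_le_of_ae_bound (Eventually.of_forall hg)

end ErrorBound

theorem mainTheorem6 (f : ℂ → ℂ) (ρ : ℝ) (hρ : 0 < ρ)
    (hf : AnalyticOnNhd ℂ f (closedStrip ρ))
    (σ : ℝ)
    (hgrowth : ∃ C R : ℝ, ∀ z ∈ closedStrip ρ, R ≤ ‖z‖ →
      ‖Complex.exp (z ^ 2 / 2) * f z‖ ≤ C * ‖z‖ ^ σ) :
    Integrable (stripBoundaryAbs f ρ) volume ∧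
    (∀ n : ℕ, ∃! h : ℝ → ℂ, IsHermiteInterpolant f n h) ∧
    ∃ K : ℕ → ℝ,
      Tendsto K atTop
        (𝓝 (stripVHat f ρ / ((2 : ℝ) ^ (1 / 4 : ℝ) * Real.pi ^ (3 / 4 : ℝ) * ρ))) ∧
      ∀ n : ℕ, max ⌊σ⌋ 1 ≤ (n : ℤ) → ∀ h : ℝ → ℂ, IsHermiteInterpolant f n h →
        eLpNorm (fun x : ℝ => f (x : ℂ) - h x) ⊤ volume ≤
          ENNReal.ofReal (K n * (n : ℝ) ^ (1 / 4 : ℝ) * Real.exp (-ρ * Real.sqrt (2 * n))) := by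
  obtain ⟨C, R, hgrowth⟩ := hgrowth
  obtain ⟨M, m, hM0, hM⟩ := exists_norm_gaussQuot_le hf hgrowth
  obtain ⟨B, hB0, hB⟩ := exists_norm_le_inv_one_add_sq hM hM0
  refine ⟨integrable_stripBoundaryAbs hρ hf hB, existsUnique_isHermiteInterpolant f, ?_⟩
  obtain ⟨A, hA0, hA⟩ := exists_norm_sub_interpolant_mul_sinh_le hρ hf hM0 hM
  set V : ℝ := stripVHat f ρ / ((2 : ℝ) ^ (1 / 4 : ℝ) * Real.pi ^ (3 / 4 : ℝ) * ρ)
  have hV : 0 ≤ V := by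
    have : 0 ≤ stripVHat f ρ := integral_nonneg fun x => by
      simp only [stripBoundaryAbs, Pi.zero_apply]; positivity
    positivity
  have hbdd : ∀ n : ℕ, ∃ b : ℝ, ∀ h : ℝ → ℂ, IsHermiteInterpolant f n h →
      ∀ x : ℝ, ‖f x - h x‖ ≤ b := by
    intro n
    obtain ⟨h₀, hh₀, huniq⟩ := existsUnique_isHermiteInterpolant f n
    obtain ⟨q, -, -, rfl⟩ := isHermiteInterpolant_iff.1 hh₀
    obtain ⟨b, hb⟩ := exists_norm_gaussMul_le q
    refine ⟨B + b, fun h hh x => ?_⟩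
    rw [huniq h hh]
    refine (norm_sub_le _ _).trans (add_le_add ?_ (hb x))
    refine (hB x (ofReal_mem_closedStrip hρ x)).trans (mul_le_of_le_one_right hB0.le ?_)
    exact inv_le_one_of_one_le₀ (by nlinarith [sq_nonneg (x : ℂ).re])
  choose b hb using hbdd
  obtain ⟨n₁, hn₁⟩ := exists_nat_ge (3 * ρ ^ 2 + 1 + 4 * (m + 1) + 1 / ρ ^ 2)
  -- From `n₁` on, the remainder added to `V` is of the order `n ^ (1 / 6 - 1 / 4)`.
  refine ⟨fun n => if n < n₁ then |b n| * Real.exp (ρ * √(2 * n)) else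
    V + 4 * A * 5 ^ (1 / 6 : ℝ) * (n : ℝ) ^ (-(1 / 12) : ℝ), ?_, ?_⟩
  · have h0 : Tendsto (fun n : ℕ => V + 4 * A * 5 ^ (1 / 6 : ℝ) * (n : ℝ) ^ (-(1 / 12) : ℝ))
        atTop (𝓝 V) := by
      have h1 := ((tendsto_rpow_neg_atTop (by norm_num : (0 : ℝ) < 1 / 12)).comp
        tendsto_natCast_atTop_atTop).const_mul (4 * A * 5 ^ (1 / 6 : ℝ))
      simpa using h1.const_add V
    refine h0.congr' ?_
    filter_upwards [eventually_ge_atTop n₁] with n hn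
    rw [if_neg (not_lt.2 hn)]
  · intro n hn h hh
    have hn1 : 1 ≤ n := by exact_mod_cast (le_max_right _ _).trans hn
    have hn1' : (1 : ℝ) ≤ n := by exact_mod_cast hn1
    refine eLpNorm_top_le_ofReal fun x => ?_
    beta_reduce
    split_ifs with hlt
    -- For `n < n₁` any bound of the error will do, as `n ^ (1 / 4) ≥ 1`.
    · have hpow : 1 ≤ (n : ℝ) ^ (1 / 4 : ℝ) := Real.one_le_rpow hn1' (by norm_num)
      have hexp : Real.exp (ρ * √(2 * n)) * Real.exp (-ρ * √(2 * n)) = 1 := by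
        rw [← Real.exp_add]; simp
      calc _ ≤ b n := hb n h hh x
        _ ≤ |b n| := le_abs_self _
        _ ≤ |b n| * (n : ℝ) ^ (1 / 4 : ℝ) := le_mul_of_one_le_right (abs_nonneg _) hpow
        _ = |b n| * (n : ℝ) ^ (1 / 4 : ℝ) *
            (Real.exp (ρ * √(2 * n)) * Real.exp (-ρ * √(2 * n))) := by rw [hexp, mul_one]
        _ = _ := by ring
    · have hnn : 3 * ρ ^ 2 + 1 + 4 * (m + 1) + 1 / ρ ^ 2 ≤ n :=
        hn₁.trans (by exact_mod_cast not_lt.1 hlt)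
      have hρ2 : 0 < 1 / ρ ^ 2 := by positivity
      have hm0 : (0 : ℝ) ≤ m := by positivity
      have h1 := hA n (by linarith) (by
        have : 4 * ((m : ℝ) + 1) ≤ n := by nlinarith [sq_nonneg ρ]
        exact_mod_cast this) h hh x
      have hs1 : 1 ≤ √(2 * n + 3) * ρ := by
        have : 1 / ρ ^ 2 ≤ 2 * n + 3 := by nlinarith [sq_nonneg ρ]
        have h2 := Real.sqrt_le_sqrt this
        rw [Real.sqrt_div zero_le_one, Real.sqrt_one, Real.sqrt_sq hρ.le, div_le_iff₀ hρ] at h2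
        exact h2
      have hs : Real.exp (ρ * √(2 * n)) ≤ 4 * Real.sinh (√(2 * n + 3) * ρ) := by
        refine le_trans (Real.exp_le_exp.2 ?_) (exp_le_four_mul_sinh hs1)
        rw [mul_comm]
        exact mul_le_mul_of_nonneg_right (Real.sqrt_le_sqrt (by linarith)) hρ.le
      have hpow : (2 * n + 3 : ℝ) ^ (1 / 6 : ℝ) ≤
          5 ^ (1 / 6 : ℝ) * ((n : ℝ) ^ (-(1 / 12) : ℝ) * (n : ℝ) ^ (1 / 4 : ℝ)) := by
        rw [← Real.rpow_add (by linarith), show (-(1 / 12) + 1 / 4 : ℝ) = 1 / 6 by norm_num,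
          ← Real.mul_rpow (by norm_num) (by positivity)]
        exact Real.rpow_le_rpow (by positivity) (by linarith) (by norm_num)
      have h2 : ‖f x - h x‖ * Real.exp (ρ * √(2 * n)) ≤
          4 * A * 5 ^ (1 / 6 : ℝ) * (n : ℝ) ^ (-(1 / 12) : ℝ) * (n : ℝ) ^ (1 / 4 : ℝ) := by
        calc _ ≤ ‖f x - h x‖ * (4 * Real.sinh (√(2 * n + 3) * ρ)) := by gcongr
          _ = 4 * (‖f x - h x‖ * Real.sinh (√(2 * n + 3) * ρ)) := by ring
          _ ≤ 4 * (A * (5 ^ (1 / 6 : ℝ) *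
              ((n : ℝ) ^ (-(1 / 12) : ℝ) * (n : ℝ) ^ (1 / 4 : ℝ)))) := by
              exact mul_le_mul_of_nonneg_left
                (h1.trans (mul_le_mul_of_nonneg_left hpow hA0.le)) (by norm_num)
          _ = _ := by ring
      have hexp : Real.exp (ρ * √(2 * n)) * Real.exp (-ρ * √(2 * n)) = 1 := by
        rw [← Real.exp_add]; simp
      calc ‖f x - h x‖ = ‖f x - h x‖ * Real.exp (ρ * √(2 * n)) * Real.exp (-ρ * √(2 * n)) := by
            rw [mul_assoc, hexp, mul_one]
        _ ≤ 4 * A * 5 ^ (1 / 6 : ℝ) * (n : ℝ) ^ (-(1 / 12) : ℝ) * (n : ℝ) ^ (1 / 4 : ℝ) *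
            Real.exp (-ρ * √(2 * n)) := by gcongr
        _ ≤ _ := by
            gcongr
            linarith
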